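/- Let $k$ be a field of characteristic $p>0$, let $\mathbb G$ be a linear algebraic group over $k$ (a smooth connected affine group scheme of finite type over $k$) with coordinate algebra $\mathcal O(\mathbb G)$, and let $\phi:\mathbb G\hookrightarrow GL_N$ be a closed embedding of group schemes. Let $d,r$ be positive integers. Write $Mod(\mathbb G)$ for the category of (not necessarily finite dimensional) $\mathbb G$-modules, that is, of right $\mathcal O(\mathbb G)$-comodules. Let $\mathcal O(\mathbb M_{N,N})=k[x_{i,j}]$, let $\mathcal O(\mathbb M_{N,N})_{\le a}$ be the space of polynomials of total degree at most $a$, and let $\mathcal O(\mathbb G_m)_{\le b}\subset\mathcal O(\mathbb G_m)=k[t,t^{-1}]$ be the span of the $t^i$ with $N|i|\le b$. Put $(\mathcal O(\mathbb M_{N,N})\otimes\mathcal O(\mathbb G_m))_{\le d}=\sum_{a+b\le d}\mathcal O(\mathbb M_{N,N})_{\le a}\otimes\mathcal O(\mathbb G_m)_{\le b}$, let $\mathcal O(GL_N)_{\le d}$ be its image under the comorphism of $GL_N\hookrightarrow\mathbb M_{N,N}\times\mathbb G_m$, $A\mapsto(A,\det(A)^{-1})$, and let $\mathcal O(\mathbb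 G)_{\le d,\phi}=\phi^*(\mathcal O(GL_N)_{\le d})$, which is a subcoalgebra of $\mathcal O(\mathbb G)$. Let $$i_{\le d,\phi}:CoMod(\mathcal O(\mathbb G)_{\le d,\phi})\hookrightarrow Mod(\mathbb G)$$ be the natural inclusion of the category of right $\mathcal O(\mathbb G)_{\le d,\phi}$-comodules, and let $$(-)_{\le d,\phi}:Mod(\mathbb G)\to CoMod(\mathcal O(\mathbb G)_{\le d,\phi})$$ be the functor sending $M$ to the largest $\mathbb G$-submodule of $M$ whose coaction takes values in its tensor product with $\mathcal O(\mathbb G)_{\le d,\phi}$. Finally, let $\mathbb G_{(r)}$ be the $r$-th Frobenius kernel of $\mathbb G$, the closed subgroup scheme defined by the ideal generated by the elements $f^{p^r}$ with $f$ in the augmentation ideal of $\mathcal O(\mathbb G)$, let $(-)_{|\mathbb G_{(r)}}:Mod(\mathbb G)\to Mod(\mathbb G_{(r)})$ be restriction, and let $ind_{\mathbb G_{(r)}}^{\mathbb G}:Mod(\mathbb G_{(r)})\to Mod(\mathbb G)$ be induction. Then the composition $$(-)_{|\mathbb G_{(r)}}\circ i_{\le d,\phi}:CoMod(\mathcal O(\mathbb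 G)_{\le d,\phi})\to Mod(\mathbb G)\to Mod(\mathbb G_{(r)})$$ is exact, the composition $$(-)_{\le d,\phi}\circ ind_{\mathbb G_{(r)}}^{\mathbb G}:Mod(\mathbb G_{(r)})\to Mod(\mathbb G)\to CoMod(\mathcal O(\mathbb G)_{\le d,\phi})$$ is left exact, and the first functor is left adjoint to the second. -/

import Mathlib

open scoped TensorProduct LaurentPolynomial
open CategoryTheory

universe u

noncomputable section

/-! ## Linear algebra over a field -/

/-- Over a field, a tensor product of injective maps is injective. -/
theorem tensorMap_injective {k : Type*} [Field k] {V W V' W' : Type*}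
    [AddCommGroup V] [Module k V] [AddCommGroup W] [Module k W]
    [AddCommGroup V'] [Module k V'] [AddCommGroup W'] [Module k W']
    {f : V →ₗ[k] V'} {g : W →ₗ[k] W'}
    (hf : Function.Injective f) (hg : Function.Injective g) :
    Function.Injective (TensorProduct.map f g) := by
  have h : TensorProduct.map f g = (f.rTensor W') ∘ₗ (g.lTensor V) := by
    ext; simp
  rw [h]
  exact (Module.Flat.rTensor_preserves_injective_linearMap f hf).comp
    (Module.Flat.lTensor_preserves_injective_linearMap g hg)

/-- The unique factorisation of a linear map through an injective linear map. -/
def factorThrough {k : Type*} [Field k] {V W X : Type*}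
    [AddCommGroup V] [Module k V] [AddCommGroup W] [Module k W] [AddCommGroup X] [Module k X]
    (j : W →ₗ[k] X) (hj : Function.Injective j) (f : V →ₗ[k] X)
    (h : ∀ v, f v ∈ LinearMap.range j) : V →ₗ[k] W :=
  (LinearEquiv.ofInjective j hj).symm.toLinearMap ∘ₗ f.codRestrict (LinearMap.range j) h

theorem comp_factorThrough {k : Type*} [Field k] {V W X : Type*}
    [AddCommGroup V] [Module k V] [AddCommGroup W] [Module k W] [AddCommGroup X] [Module k X]
    (j : W →ₗ[k] X) (hj : Function.Injective j) (f : V →ₗ[k] X)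
    (h : ∀ v, f v ∈ LinearMap.range j) : j ∘ₗ factorThrough j hj f h = f := by
  ext v
  exact congrArg Subtype.val ((LinearEquiv.ofInjective j hj).apply_symm_apply ⟨f v, h v⟩)

/-- Coassociativity restricts along injective maps. -/
theorem coassoc_restrict {k : Type*} [Field k] {M C N D : Type*}
    [AddCommGroup M] [Module k M] [AddCommGroup C] [Module k C]
    [AddCommGroup N] [Module k N] [AddCommGroup D] [Module k D]
    {i : N →ₗ[k] M} {j : D →ₗ[k] C} (hi : Function.Injective i) (hj : Function.Injective j)
    {ρ : M →ₗ[k] M ⊗[k] C} {δ : N →ₗ[k] N ⊗[k] D}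
    {ΔC : C →ₗ[k] C ⊗[k] C} {ΔD : D →ₗ[k] D ⊗[k] D}
    (hδ : TensorProduct.map i j ∘ₗ δ = ρ ∘ₗ i) (hΔ : TensorProduct.map j j ∘ₗ ΔD = ΔC ∘ₗ j)
    (h : (TensorProduct.assoc k M C C).toLinearMap ∘ₗ ρ.rTensor C ∘ₗ ρ = ΔC.lTensor M ∘ₗ ρ) :
    (TensorProduct.assoc k N D D).toLinearMap ∘ₗ δ.rTensor D ∘ₗ δ = ΔD.lTensor N ∘ₗ δ := by
  have hδ' : ∀ n, TensorProduct.map i j (δ n) = ρ (i n) := fun n => DFunLike.congr_fun hδ n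
  have hΔ' : ∀ d, TensorProduct.map j j (ΔD d) = ΔC (j d) := fun d => DFunLike.congr_fun hΔ d
  have h' : ∀ m, TensorProduct.assoc k M C C (ρ.rTensor C (ρ m)) = ΔC.lTensor M (ρ m) :=
    fun m => DFunLike.congr_fun h m
  have h1 : ∀ (s : N ⊗[k] D) (d : D),
      TensorProduct.map i (TensorProduct.map j j) (TensorProduct.assoc k N D D (s ⊗ₜ d)) =
        TensorProduct.assoc k M C C ((TensorProduct.map i j s) ⊗ₜ j d) := by
    intro s d
    induction s using TensorProduct.induction_on with
    | zero => simp
    | tmul => simp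
    | add x y hx hy => simp only [TensorProduct.add_tmul, map_add, hx, hy]
  have h2 : ∀ t : N ⊗[k] D,
      TensorProduct.map i (TensorProduct.map j j) (TensorProduct.assoc k N D D (δ.rTensor D t)) =
        TensorProduct.assoc k M C C (ρ.rTensor C (TensorProduct.map i j t)) := by
    intro t
    induction t using TensorProduct.induction_on with
    | zero => simp
    | tmul n d => rw [LinearMap.rTensor_tmul, h1, hδ']; simp
    | add x y hx hy => simp only [map_add, hx, hy]
  have h3 : ∀ t : N ⊗[k] D,
      TensorProduct.map i (TensorProduct.map j j) (ΔD.lTensor N t) =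
        ΔC.lTensor M (TensorProduct.map i j t) := by
    intro t
    induction t using TensorProduct.induction_on with
    | zero => simp
    | tmul n d => simp [hΔ']
    | add x y hx hy => simp only [map_add, hx, hy]
  ext n
  apply tensorMap_injective hi (tensorMap_injective hj hj)
  simp only [LinearMap.comp_apply, LinearEquiv.coe_coe]
  rw [h2, h3, hδ', h']

/-- The counit axiom restricts along injective maps. -/
theorem counit_restrict {k : Type*} [Field k] {M C N D : Type*}
    [AddCommGroup M] [Module k M] [AddCommGroup C] [Module k C]
    [AddCommGroup N] [Module k N] [AddCommGroup D] [Module k D]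
    {i : N →ₗ[k] M} {j : D →ₗ[k] C} (hi : Function.Injective i)
    {ρ : M →ₗ[k] M ⊗[k] C} {δ : N →ₗ[k] N ⊗[k] D} {ε : C →ₗ[k] k}
    (hδ : TensorProduct.map i j ∘ₗ δ = ρ ∘ₗ i)
    (h : (TensorProduct.rid k M).toLinearMap ∘ₗ ε.lTensor M ∘ₗ ρ = LinearMap.id) :
    (TensorProduct.rid k N).toLinearMap ∘ₗ (ε ∘ₗ j).lTensor N ∘ₗ δ = LinearMap.id := by
  have h1 : ∀ t : N ⊗[k] D, i (TensorProduct.rid k N ((ε ∘ₗ j).lTensor N t)) =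
      TensorProduct.rid k M (ε.lTensor M (TensorProduct.map i j t)) := by
    intro t
    induction t using TensorProduct.induction_on with
    | zero => simp
    | tmul n d => simp
    | add x y hx hy => simp only [map_add, hx, hy]
  ext n
  apply hi
  have h2 := DFunLike.congr_fun hδ n
  have h3 := DFunLike.congr_fun h (i n)
  simp only [LinearMap.comp_apply, LinearEquiv.coe_coe, LinearMap.id_apply] at h2 h3 ⊢
  rw [h1, h2, h3]

/-! ## Subcoalgebras -/

/-- A subspace `X` of a coalgebra `C` is a subcoalgebra if `Δ(X) ⊆ X ⊗ X`. -/
class Submodule.IsSubcoalgebra {k C : Type*} [Field k] [AddCommGroup C] [Module k C]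
    [Coalgebra k C] (X : Submodule k C) : Prop where
  comul_mem : ∀ x ∈ X,
    (Coalgebra.comul x : C ⊗[k] C) ∈ LinearMap.range (TensorProduct.map X.subtype X.subtype)

namespace Subcoalgebra

variable {k C : Type*} [Field k] [AddCommGroup C] [Module k C] [Coalgebra k C]
  (X : Submodule k C) [X.IsSubcoalgebra]

/-- The restriction `X → X ⊗ X` of the comultiplication to a subcoalgebra. -/
def comul : X →ₗ[k] X ⊗[k] X :=
  factorThrough (TensorProduct.map X.subtype X.subtype)
    (tensorMap_injective X.injective_subtype X.injective_subtype)
    (Coalgebra.comul ∘ₗ X.subtype)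
    (fun x => Submodule.IsSubcoalgebra.comul_mem x.1 x.2)

theorem map_comp_comul :
    TensorProduct.map X.subtype X.subtype ∘ₗ comul X = Coalgebra.comul ∘ₗ X.subtype :=
  comp_factorThrough _ _ _ _

instance instCoalgebraStruct : CoalgebraStruct k X where
  comul := comul X
  counit := Coalgebra.counit ∘ₗ X.subtype

instance instCoalgebra : Coalgebra k X where
  coassoc := coassoc_restrict X.injective_subtype X.injective_subtype (map_comp_comul X)
    (map_comp_comul X) Coalgebra.coassoc
  rTensor_counit_comp_comul := by
    have h1 : ∀ t : X ⊗[k] X, X.subtype (TensorProduct.lid k X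
        (((Coalgebra.counit : C →ₗ[k] k) ∘ₗ X.subtype).rTensor X t)) =
        TensorProduct.lid k C (Coalgebra.counit.rTensor C
          (TensorProduct.map X.subtype X.subtype t)) := by
      intro t
      induction t using TensorProduct.induction_on with
      | zero => simp
      | tmul n d => simp
      | add x y hx hy => simp only [map_add, hx, hy]
    refine LinearMap.ext fun x => ?_
    apply (TensorProduct.lid k X).injective
    apply X.injective_subtype
    have h2 := DFunLike.congr_fun (map_comp_comul X) x
    have h3 := Coalgebra.rTensor_counit_comul (R := k) x.1
    simp only [LinearMap.comp_apply] at h2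
    change X.subtype (TensorProduct.lid k X
        (((Coalgebra.counit : C →ₗ[k] k) ∘ₗ X.subtype).rTensor X (comul X x))) = _
    rw [h1, h2, Submodule.subtype_apply, h3]
    simp
  lTensor_counit_comp_comul := by
    have h := counit_restrict (ε := (Coalgebra.counit : C →ₗ[k] k)) X.injective_subtype
      (map_comp_comul X) (by ext x; simp)
    refine LinearMap.ext fun x => ?_
    apply (TensorProduct.rid k X).injective
    exact (DFunLike.congr_fun h x).trans (by simp)

/-- The inclusion of a subcoalgebra, as a homomorphism of coalgebras. -/
def incl : X →ₗc[k] C where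
  toLinearMap := X.subtype
  counit_comp := rfl
  map_comp_comul := map_comp_comul X

end Subcoalgebra

/-! ## Comodules -/

/-- A right comodule over a coalgebra `C` over a field `k`: a vector space `M` with a coaction
`M → M ⊗ C` that is coassociative and counital. -/
structure Comod (k C : Type u) [Field k] [AddCommGroup C] [Module k C] [Coalgebra k C] where
  carrier : Type u
  [addCommGroup : AddCommGroup carrier]
  [module : Module k carrier]
  coact : carrier →ₗ[k] carrier ⊗[k] C
  coassoc : (TensorProduct.assoc k carrier C C).toLinearMap ∘ₗ coact.rTensor C ∘ₗ coact =
    Coalgebra.comul.lTensor carrier ∘ₗ coact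
  counit : (TensorProduct.rid k carrier).toLinearMap ∘ₗ
    Coalgebra.counit.lTensor carrier ∘ₗ coact = LinearMap.id

attribute [instance] Comod.addCommGroup Comod.module

namespace Comod

section Category

variable {k C : Type u} [Field k] [AddCommGroup C] [Module k C] [Coalgebra k C]

/-- A homomorphism of comodules: a linear map that commutes with the coactions. -/
@[ext]
structure Hom (M N : Comod k C) where
  toLinearMap : M.carrier →ₗ[k] N.carrier
  comm : N.coact ∘ₗ toLinearMap = toLinearMap.rTensor C ∘ₗ M.coact

/-- The category of right `C`-comodules. -/
instance instCategory : Category (Comod k C) where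
  Hom M N := Hom M N
  id M := ⟨LinearMap.id, by rw [LinearMap.rTensor_id]; rfl⟩
  comp f g := ⟨g.toLinearMap ∘ₗ f.toLinearMap, by
    rw [LinearMap.rTensor_comp, LinearMap.comp_assoc, ← f.comm, ← LinearMap.comp_assoc,
      g.comm, LinearMap.comp_assoc]⟩

end Category

section Pushforward

variable {k C D : Type u} [Field k] [AddCommGroup C] [Module k C] [Coalgebra k C]
  [AddCommGroup D] [Module k D] [Coalgebra k D]

/-- A homomorphism of coalgebras `g : C → D` turns a `C`-comodule `M` into a `D`-comodule with the
same underlying vector space and coaction `M → M ⊗ C → M ⊗ D`. -/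
def pushforwardObj (g : C →ₗc[k] D) (M : Comod k C) : Comod k D where
  carrier := M.carrier
  coact := g.toLinearMap.lTensor M.carrier ∘ₗ M.coact
  coassoc := by
    have hg : ∀ c, TensorProduct.map g.toLinearMap g.toLinearMap (Coalgebra.comul c) =
        Coalgebra.comul (R := k) (g.toLinearMap c) := fun c =>
      DFunLike.congr_fun g.map_comp_comul c
    have h1 : ∀ (s : M.carrier ⊗[k] C) (c : C),
        TensorProduct.assoc k M.carrier D D ((g.toLinearMap.lTensor M.carrier s) ⊗ₜ
          g.toLinearMap c) = (TensorProduct.map g.toLinearMap g.toLinearMap).lTensor M.carrier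
            (TensorProduct.assoc k M.carrier C C (s ⊗ₜ c)) := by
      intro s c
      induction s using TensorProduct.induction_on with
      | zero => simp
      | tmul => simp
      | add x y hx hy => simp only [TensorProduct.add_tmul, map_add, hx, hy]
    have h2 : ∀ t : M.carrier ⊗[k] C, TensorProduct.assoc k M.carrier D D
        ((g.toLinearMap.lTensor M.carrier ∘ₗ M.coact).rTensor D
          (g.toLinearMap.lTensor M.carrier t)) =
        (TensorProduct.map g.toLinearMap g.toLinearMap).lTensor M.carrier
          (TensorProduct.assoc k M.carrier C C (M.coact.rTensor C t)) := by
      intro t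
      induction t using TensorProduct.induction_on with
      | zero => simp
      | tmul m c => exact h1 _ c
      | add x y hx hy => simp only [map_add, hx, hy]
    have h3 : ∀ t : M.carrier ⊗[k] C,
        (TensorProduct.map g.toLinearMap g.toLinearMap).lTensor M.carrier
          (Coalgebra.comul.lTensor M.carrier t) =
        Coalgebra.comul.lTensor M.carrier (g.toLinearMap.lTensor M.carrier t) := by
      intro t
      induction t using TensorProduct.induction_on with
      | zero => simp
      | tmul m c => simp only [LinearMap.lTensor_tmul, hg]
      | add x y hx hy => simp only [map_add, hx, hy]
    refine LinearMap.ext fun m => ?_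
    exact (h2 _).trans ((congrArg _ (DFunLike.congr_fun M.coassoc m)).trans (h3 _))
  counit := by
    rw [← LinearMap.comp_assoc (M.coact), ← LinearMap.lTensor_comp, g.counit_comp]
    exact M.counit

/-- The functor from `C`-comodules to `D`-comodules given by a homomorphism of coalgebras
`g : C → D`; it does not change the underlying linear maps. -/
def pushforward (g : C →ₗc[k] D) : Comod k C ⥤ Comod k D where
  obj M := pushforwardObj g M
  map {M N} f := ⟨f.toLinearMap, by
    change (g.toLinearMap.lTensor N.carrier ∘ₗ N.coact) ∘ₗ f.toLinearMap =
      f.toLinearMap.rTensor D ∘ₗ g.toLinearMap.lTensor M.carrier ∘ₗ M.coact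
    rw [LinearMap.comp_assoc, f.comm, ← LinearMap.comp_assoc, ← LinearMap.comp_assoc,
      LinearMap.lTensor_comp_rTensor, LinearMap.rTensor_comp_lTensor]⟩
  map_id _ := rfl
  map_comp _ _ := rfl

end Pushforward

section Restrict

variable {k C D : Type u} [Field k] [AddCommGroup C] [Module k C] [Coalgebra k C]
  [AddCommGroup D] [Module k D] [Coalgebra k D]

/-- Let `j : D → C` be an injective homomorphism of coalgebras, `M` a `C`-comodule and `N` a
subspace of `M` with `Δ_M(N) ⊆ N ⊗ D`.  Then `N` is a `D`-comodule. -/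
def restrict (j : D →ₗc[k] C) (hj : Function.Injective j.toLinearMap) (M : Comod k C)
    (N : Submodule k M.carrier)
    (hN : ∀ n : N, M.coact n ∈ LinearMap.range (TensorProduct.map N.subtype j.toLinearMap)) :
    Comod k D where
  carrier := N
  coact := factorThrough (TensorProduct.map N.subtype j.toLinearMap)
    (tensorMap_injective N.injective_subtype hj) (M.coact ∘ₗ N.subtype) hN
  coassoc := coassoc_restrict N.injective_subtype hj (comp_factorThrough _ _ _ _)
    j.map_comp_comul M.coassoc
  counit := by
    rw [← j.counit_comp]
    exact counit_restrict N.injective_subtype (comp_factorThrough _ _ _ _) M.counit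

theorem restrict_coact (j : D →ₗc[k] C) (hj : Function.Injective j.toLinearMap) (M : Comod k C)
    (N : Submodule k M.carrier)
    (hN : ∀ n : N, M.coact n ∈ LinearMap.range (TensorProduct.map N.subtype j.toLinearMap)) :
    TensorProduct.map N.subtype j.toLinearMap ∘ₗ (restrict j hj M N hN).coact =
      M.coact ∘ₗ N.subtype :=
  comp_factorThrough _ _ _ _

/-- A homomorphism of `C`-comodules that maps `N ⊆ M` into `N' ⊆ M'` restricts to a homomorphism
of `D`-comodules. -/
def restrictMap (j : D →ₗc[k] C) (hj : Function.Injective j.toLinearMap) {M M' : Comod k C}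
    (N : Submodule k M.carrier) (N' : Submodule k M'.carrier)
    (hN : ∀ n : N, M.coact n ∈ LinearMap.range (TensorProduct.map N.subtype j.toLinearMap))
    (hN' : ∀ n : N', M'.coact n ∈ LinearMap.range (TensorProduct.map N'.subtype j.toLinearMap))
    (f : M ⟶ M') (hf : ∀ n ∈ N, Hom.toLinearMap f n ∈ N') :
    restrict j hj M N hN ⟶ restrict j hj M' N' hN' where
  toLinearMap := (Hom.toLinearMap f).restrict hf
  comm := by
    refine LinearMap.ext fun n => tensorMap_injective N'.injective_subtype hj ?_
    have h1 : ∀ t : N ⊗[k] D, TensorProduct.map N'.subtype j.toLinearMap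
        (((Hom.toLinearMap f).restrict hf).rTensor D t) =
        (Hom.toLinearMap f).rTensor C (TensorProduct.map N.subtype j.toLinearMap t) := by
      intro t
      induction t using TensorProduct.induction_on with
      | zero => simp
      | tmul n d => simp
      | add x y hx hy => simp only [map_add, hx, hy]
    have h2 := DFunLike.congr_fun (restrict_coact j hj M N hN) n
    have h3 := DFunLike.congr_fun (restrict_coact j hj M' N' hN')
      ((Hom.toLinearMap f).restrict hf n)
    have h4 := DFunLike.congr_fun (Hom.comm f) (N.subtype n)
    exact h3.trans (h4.trans ((congrArg _ h2.symm).trans (h1 _).symm))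

end Restrict

section Truncation

variable {k C : Type u} [Field k] [AddCommGroup C] [Module k C] [Coalgebra k C]

/-- `N ⊆ M` is an `X`-subcomodule if `Δ_M(N) ⊆ N ⊗ X`. -/
def IsSubcomoduleIn (X : Submodule k C) (M : Comod k C) (N : Submodule k M.carrier) : Prop :=
  ∀ n ∈ N, M.coact n ∈ LinearMap.range (TensorProduct.map N.subtype X.subtype)

/-- `M_X`, the sum of all `X`-subcomodules of `M`. -/
def largest (X : Submodule k C) (M : Comod k C) : Submodule k M.carrier :=
  sSup {N | IsSubcomoduleIn X M N}

theorem largest_isSubcomoduleIn (X : Submodule k C) (M : Comod k C) :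
    IsSubcomoduleIn X M (largest X M) := by
  suffices h : largest X M ≤
      (LinearMap.range (TensorProduct.map (largest X M).subtype X.subtype)).comap M.coact from
    fun n hn => h hn
  refine sSup_le fun N hN n hn => ?_
  have hle : N ≤ largest X M := le_sSup hN
  obtain ⟨t, ht⟩ := hN n hn
  refine ⟨(Submodule.inclusion hle).rTensor X t, ?_⟩
  rw [← ht, ← LinearMap.comp_apply]
  congr 1
  refine TensorProduct.ext' fun n x => ?_
  simp

theorem map_largest_le (X : Submodule k C) {M M' : Comod k C} (f : M ⟶ M') :
    ∀ n ∈ largest X M, Hom.toLinearMap f n ∈ largest X M' := by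
  intro n hn
  have hN : IsSubcomoduleIn X M' ((largest X M).map (Hom.toLinearMap f)) := by
    rintro _ ⟨m, hm, rfl⟩
    obtain ⟨t, ht⟩ := largest_isSubcomoduleIn X M m hm
    refine ⟨((Hom.toLinearMap f).submoduleMap (largest X M)).rTensor X t, ?_⟩
    have h := DFunLike.congr_fun (Hom.comm f) m
    simp only [LinearMap.comp_apply] at h
    rw [h, ← ht, ← LinearMap.comp_apply, ← LinearMap.comp_apply]
    congr 1
    refine TensorProduct.ext' fun n x => ?_
    simp
  exact (le_sSup hN : _ ≤ largest X M') ⟨n, hn, rfl⟩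

/-- For a subcoalgebra `X` of `C`, the functor `M ↦ M_X` from `C`-comodules to `X`-comodules. -/
def truncation (X : Submodule k C) [X.IsSubcoalgebra] : Comod k C ⥤ Comod k X where
  obj M := restrict (Subcoalgebra.incl X) X.injective_subtype M (largest X M)
    (fun n => largest_isSubcomoduleIn X M n n.2)
  map f := restrictMap (Subcoalgebra.incl X) X.injective_subtype _ _ _ _ f (map_largest_le X f)
  map_id _ := rfl
  map_comp _ _ := rfl

end Truncation

section Induction

variable {k C D : Type u} [Field k] [AddCommGroup C] [Module k C] [Coalgebra k C]
  [AddCommGroup D] [Module k D] [Coalgebra k D]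

/-- For a vector space `V`, the `C`-comodule `V ⊗ C` with coaction `id ⊗ Δ`. -/
def cofree (C : Type u) [AddCommGroup C] [Module k C] [Coalgebra k C]
    (V : Type u) [AddCommGroup V] [Module k V] : Comod k C where
  carrier := V ⊗[k] C
  coact := (TensorProduct.assoc k V C C).symm.toLinearMap ∘ₗ Coalgebra.comul.lTensor V
  coassoc := by
    have h1 : ∀ (v : V) (s : C ⊗[k] C) (b : C),
        TensorProduct.assoc k (V ⊗[k] C) C C ((TensorProduct.assoc k V C C).symm (v ⊗ₜ s) ⊗ₜ b) =
        (TensorProduct.assoc k V C (C ⊗[k] C)).symm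
          (v ⊗ₜ TensorProduct.assoc k C C C (s ⊗ₜ b)) := by
      intro v s b
      induction s using TensorProduct.induction_on with
      | zero => simp
      | tmul => simp
      | add x y hx hy => simp only [TensorProduct.add_tmul, TensorProduct.tmul_add, map_add, hx, hy]
    have h2 : ∀ (v : V) (t : C ⊗[k] C), TensorProduct.assoc k (V ⊗[k] C) C C
        (((TensorProduct.assoc k V C C).symm.toLinearMap ∘ₗ
          Coalgebra.comul.lTensor V).rTensor C ((TensorProduct.assoc k V C C).symm (v ⊗ₜ t))) =
        (TensorProduct.assoc k V C (C ⊗[k] C)).symm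
          (v ⊗ₜ TensorProduct.assoc k C C C (Coalgebra.comul.rTensor C t)) := by
      intro v t
      induction t using TensorProduct.induction_on with
      | zero => simp
      | tmul a b => simp [h1]
      | add x y hx hy => simp only [TensorProduct.tmul_add, map_add, hx, hy]
    have h3 : ∀ (v : V) (t : C ⊗[k] C),
        Coalgebra.comul.lTensor (V ⊗[k] C) ((TensorProduct.assoc k V C C).symm (v ⊗ₜ t)) =
        (TensorProduct.assoc k V C (C ⊗[k] C)).symm (v ⊗ₜ Coalgebra.comul.lTensor C t) := by
      intro v t
      induction t using TensorProduct.induction_on with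
      | zero => simp
      | tmul a b => simp
      | add x y hx hy => simp only [TensorProduct.tmul_add, map_add, hx, hy]
    refine TensorProduct.ext' fun v c => ?_
    have h := h2 v (Coalgebra.comul c)
    rw [Coalgebra.coassoc_apply] at h
    exact h.trans (h3 v _).symm
  counit := by
    have h1 : ∀ (v : V) (t : C ⊗[k] C), TensorProduct.rid k (V ⊗[k] C)
        (Coalgebra.counit.lTensor (V ⊗[k] C) ((TensorProduct.assoc k V C C).symm (v ⊗ₜ t))) =
        v ⊗ₜ TensorProduct.rid k C (Coalgebra.counit.lTensor C t) := by
      intro v t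
      induction t using TensorProduct.induction_on with
      | zero => simp
      | tmul a b => simp
      | add x y hx hy => simp only [TensorProduct.tmul_add, map_add, hx, hy]
    refine TensorProduct.ext' fun v c => ?_
    have h := h1 v (Coalgebra.comul c)
    rw [Coalgebra.lTensor_counit_comul] at h
    exact h.trans (by simp)

/-- The map `n ⊗ c ↦ Δ_N(n) ⊗ c`. -/
def cotensorLeft (C : Type u) [AddCommGroup C] [Module k C] (N : Comod k D) :
    N.carrier ⊗[k] C →ₗ[k] N.carrier ⊗[k] (D ⊗[k] C) :=
  (TensorProduct.assoc k N.carrier D C).toLinearMap ∘ₗ N.coact.rTensor C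

/-- The map `n ⊗ c ↦ n ⊗ (g ⊗ id)(Δ(c))`. -/
def cotensorRight (g : C →ₗc[k] D) (N : Comod k D) :
    N.carrier ⊗[k] C →ₗ[k] N.carrier ⊗[k] (D ⊗[k] C) :=
  (g.toLinearMap.rTensor C ∘ₗ Coalgebra.comul).lTensor N.carrier

/-- The cotensor product of `N` and `C` over `D`: the equaliser of the two maps above. -/
def cotensor (g : C →ₗc[k] D) (N : Comod k D) : Submodule k (N.carrier ⊗[k] C) :=
  LinearMap.eqLocus (cotensorLeft C N) (cotensorRight g N)

theorem cotensor_coact_mem (g : C →ₗc[k] D) (N : Comod k D) (x : cotensor g N) :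
    (cofree C N.carrier).coact x.1 ∈ LinearMap.range
      (TensorProduct.map (cotensor g N).subtype (CoalgHom.id k C).toLinearMap) := by
  let Φ : N.carrier ⊗[k] (D ⊗[k] C) →ₗ[k] (N.carrier ⊗[k] (D ⊗[k] C)) ⊗[k] C :=
    (TensorProduct.assoc k N.carrier (D ⊗[k] C) C).symm.toLinearMap ∘ₗ
      ((TensorProduct.assoc k D C C).symm.toLinearMap ∘ₗ
        Coalgebra.comul.lTensor D).lTensor N.carrier
  have hL : ∀ y : N.carrier ⊗[k] C,
      (cotensorLeft C N).rTensor C ((cofree C N.carrier).coact y) = Φ (cotensorLeft C N y) := by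
    have h1 : ∀ (s : N.carrier ⊗[k] D) (a b : C), (TensorProduct.assoc k N.carrier D C (s ⊗ₜ a)) ⊗ₜ b
        = (TensorProduct.assoc k N.carrier (D ⊗[k] C) C).symm
          ((TensorProduct.assoc k D C C).symm.toLinearMap.lTensor N.carrier
            (TensorProduct.assoc k N.carrier D (C ⊗[k] C) (s ⊗ₜ (a ⊗ₜ[k] b)))) := by
      intro s a b
      induction s using TensorProduct.induction_on with
      | zero => simp
      | tmul => simp
      | add x y hx hy => simp only [TensorProduct.add_tmul, map_add, hx, hy]
    have h2 : ∀ (n : N.carrier) (t : C ⊗[k] C), (cotensorLeft C N).rTensor C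
        ((TensorProduct.assoc k N.carrier C C).symm (n ⊗ₜ t)) =
        (TensorProduct.assoc k N.carrier (D ⊗[k] C) C).symm
          ((TensorProduct.assoc k D C C).symm.toLinearMap.lTensor N.carrier
            (TensorProduct.assoc k N.carrier D (C ⊗[k] C) (N.coact n ⊗ₜ t))) := by
      intro n t
      induction t using TensorProduct.induction_on with
      | zero => simp
      | tmul a b => simp [cotensorLeft, h1]
      | add x y hx hy => simp only [TensorProduct.tmul_add, map_add, hx, hy]
    have h3 : ∀ (s : N.carrier ⊗[k] D) (c : C),
        (TensorProduct.assoc k D C C).symm.toLinearMap.lTensor N.carrier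
            (TensorProduct.assoc k N.carrier D (C ⊗[k] C) (s ⊗ₜ Coalgebra.comul c)) =
        ((TensorProduct.assoc k D C C).symm.toLinearMap ∘ₗ
          Coalgebra.comul.lTensor D).lTensor N.carrier
            (TensorProduct.assoc k N.carrier D C (s ⊗ₜ c)) := by
      intro s c
      induction s using TensorProduct.induction_on with
      | zero => simp
      | tmul => simp
      | add x y hx hy => simp only [TensorProduct.add_tmul, map_add, hx, hy]
    refine DFunLike.congr_fun (f := (cotensorLeft C N).rTensor C ∘ₗ (cofree C N.carrier).coact)
      (g := Φ ∘ₗ cotensorLeft C N) (TensorProduct.ext' fun n c => ?_)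
    exact (h2 n _).trans (congrArg _ (h3 _ c))
  have hR : ∀ y : N.carrier ⊗[k] C,
      (cotensorRight g N).rTensor C ((cofree C N.carrier).coact y) = Φ (cotensorRight g N y) := by
    have h0 : ∀ (s : C ⊗[k] C) (b : C), (g.toLinearMap.rTensor C s) ⊗ₜ[k] b =
        (TensorProduct.assoc k D C C).symm (g.toLinearMap.rTensor (C ⊗[k] C)
          (TensorProduct.assoc k C C C (s ⊗ₜ b))) := by
      intro s b
      induction s using TensorProduct.induction_on with
      | zero => simp
      | tmul => simp
      | add x y hx hy => simp only [TensorProduct.add_tmul, map_add, hx, hy]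
    have h1 : ∀ (n : N.carrier) (t : C ⊗[k] C), (cotensorRight g N).rTensor C
        ((TensorProduct.assoc k N.carrier C C).symm (n ⊗ₜ t)) =
        (TensorProduct.assoc k N.carrier (D ⊗[k] C) C).symm (n ⊗ₜ
          (TensorProduct.assoc k D C C).symm (g.toLinearMap.rTensor (C ⊗[k] C)
            (TensorProduct.assoc k C C C (Coalgebra.comul.rTensor C t)))) := by
      intro n t
      induction t using TensorProduct.induction_on with
      | zero => simp
      | tmul a b =>
        rw [LinearMap.rTensor_tmul, ← h0]
        simp [cotensorRight]
      | add x y hx hy => simp only [TensorProduct.tmul_add, map_add, hx, hy]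
    have h2 : ∀ t : C ⊗[k] C, g.toLinearMap.rTensor (C ⊗[k] C) (Coalgebra.comul.lTensor C t) =
        Coalgebra.comul.lTensor D (g.toLinearMap.rTensor C t) := by
      intro t
      induction t using TensorProduct.induction_on with
      | zero => simp
      | tmul a b => simp
      | add x y hx hy => simp only [map_add, hx, hy]
    refine DFunLike.congr_fun (f := (cotensorRight g N).rTensor C ∘ₗ (cofree C N.carrier).coact)
      (g := Φ ∘ₗ cotensorRight g N) (TensorProduct.ext' fun n c => ?_)
    refine (h1 n (Coalgebra.comul c)).trans ?_
    rw [Coalgebra.coassoc_apply, h2]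
    rfl
  have hex : Function.Exact ((cotensor g N).subtype.rTensor C)
      ((cotensorLeft C N - cotensorRight g N).rTensor C) := by
    refine Module.Flat.rTensor_exact C ?_
    intro y
    rw [LinearMap.sub_apply, sub_eq_zero]
    constructor
    · exact fun h => ⟨⟨y, h⟩, rfl⟩
    · rintro ⟨a, rfl⟩
      exact a.2
  refine (hex _).1 ?_
  rw [LinearMap.rTensor_sub]
  exact sub_eq_zero.2 ((hL x.1).trans ((congrArg Φ x.2).trans (hR x.1).symm))

theorem cotensor_map_mem (g : C →ₗc[k] D) {N N' : Comod k D} (f : N ⟶ N') :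
    ∀ x ∈ cotensor g N, (Hom.toLinearMap f).rTensor C x ∈ cotensor g N' := by
  have hL : ∀ x, cotensorLeft C N' ((Hom.toLinearMap f).rTensor C x) =
      (Hom.toLinearMap f).rTensor (D ⊗[k] C) (cotensorLeft C N x) := by
    have h1 : ∀ (s : N.carrier ⊗[k] D) (c : C),
        TensorProduct.assoc k N'.carrier D C (((Hom.toLinearMap f).rTensor D s) ⊗ₜ c) =
        (Hom.toLinearMap f).rTensor (D ⊗[k] C) (TensorProduct.assoc k N.carrier D C (s ⊗ₜ c)) := by
      intro s c
      induction s using TensorProduct.induction_on with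
      | zero => simp
      | tmul => simp
      | add x y hx hy => simp only [TensorProduct.add_tmul, map_add, hx, hy]
    intro x
    induction x using TensorProduct.induction_on with
    | zero => simp
    | tmul n c =>
      have h := DFunLike.congr_fun (Hom.comm f) n
      simp only [LinearMap.comp_apply] at h
      simp [cotensorLeft, h, h1]
    | add x y hx hy => simp only [map_add, hx, hy]
  have hR : ∀ x, cotensorRight g N' ((Hom.toLinearMap f).rTensor C x) =
      (Hom.toLinearMap f).rTensor (D ⊗[k] C) (cotensorRight g N x) := by
    intro x
    induction x using TensorProduct.induction_on with
    | zero => simp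
    | tmul n c => simp [cotensorRight]
    | add x y hx hy => simp only [map_add, hx, hy]
  intro x hx
  have hx' : cotensorLeft C N x = cotensorRight g N x := hx
  change cotensorLeft C N' _ = cotensorRight g N' _
  rw [hL, hR, hx']

/-- The map `f ⊗ id : V ⊗ C → V' ⊗ C`, as a homomorphism of comodules. -/
def cofreeMap {V V' : Type u} [AddCommGroup V] [Module k V] [AddCommGroup V'] [Module k V']
    (f : V →ₗ[k] V') : cofree (k := k) C V ⟶ cofree (k := k) C V' where
  toLinearMap := f.rTensor C
  comm := by
    have h1 : ∀ (v : V) (t : C ⊗[k] C), (TensorProduct.assoc k V' C C).symm (f v ⊗ₜ t) =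
        (f.rTensor C).rTensor C ((TensorProduct.assoc k V C C).symm (v ⊗ₜ t)) := by
      intro v t
      induction t using TensorProduct.induction_on with
      | zero => simp
      | tmul a b => simp
      | add x y hx hy => simp only [TensorProduct.tmul_add, map_add, hx, hy]
    exact TensorProduct.ext' fun v c => h1 v _

/-- Induction along a homomorphism of coalgebras `g : C → D`: the functor sending a `D`-comodule
`N` to its cotensor product with `C`, with coaction `id ⊗ Δ`.

For a closed subgroup scheme `H ⊆ G` and `g` the quotient map `O(G) → O(H)`, the space `N ⊗ O(G)`
consists of the morphisms `f : G → N`, the cotensor product is the subspace of those with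
`f(h x) = h f(x)` for `h` in `H` and `x` in `G`, and `G` acts by `(y f)(x) = f(x y)`.  This is
`ind_H^G N`; the substitution `x ↦ x⁻¹` gives the description of `ind_H^G N` as the space of
the `f` with `f(x h) = h⁻¹ f(x)` on which `G` acts by `(y f)(x) = f(y⁻¹ x)`. -/
def induction (g : C →ₗc[k] D) : Comod k D ⥤ Comod k C where
  obj N := restrict (CoalgHom.id k C) Function.injective_id (cofree C N.carrier) (cotensor g N)
    (cotensor_coact_mem g N)
  map f := restrictMap (CoalgHom.id k C) Function.injective_id _ _ _ _
    (cofreeMap (Hom.toLinearMap f)) (cotensor_map_mem g f)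
  map_id N := by
    refine Hom.ext (LinearMap.ext fun x => Subtype.ext ?_)
    exact LinearMap.rTensor_id_apply C N.carrier _
  map_comp f f' := by
    refine Hom.ext (LinearMap.ext fun x => Subtype.ext ?_)
    exact LinearMap.rTensor_comp_apply C (Hom.toLinearMap f') (Hom.toLinearMap f) _

end Induction

end Comod

/-! ## The coordinate algebra of `GL_N` -/

/-- The coordinate algebra `k[x_{ij}][1/det]` of the group scheme `GL_N` over `k`. -/
def GLCoord (N : ℕ) (k : Type u) [Field k] : Type u :=
  Localization.Away (Matrix.mvPolynomialX (Fin N) (Fin N) k).det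

namespace GLCoord

variable (N : ℕ) (k : Type u) [Field k]

instance instCommRing : CommRing (GLCoord N k) :=
  inferInstanceAs (CommRing (Localization.Away (Matrix.mvPolynomialX (Fin N) (Fin N) k).det))

instance instAlgebra : Algebra k (GLCoord N k) :=
  inferInstanceAs (Algebra k (Localization.Away (Matrix.mvPolynomialX (Fin N) (Fin N) k).det))

instance instAlgebraPoly : Algebra (MvPolynomial (Fin N × Fin N) k) (GLCoord N k) :=
  inferInstanceAs (Algebra (MvPolynomial (Fin N × Fin N) k)
    (Localization.Away (Matrix.mvPolynomialX (Fin N) (Fin N) k).det))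

instance instIsScalarTower : IsScalarTower k (MvPolynomial (Fin N × Fin N) k) (GLCoord N k) :=
  inferInstanceAs (IsScalarTower k (MvPolynomial (Fin N × Fin N) k)
    (Localization.Away (Matrix.mvPolynomialX (Fin N) (Fin N) k).det))

instance instIsLocalization :
    IsLocalization.Away (Matrix.mvPolynomialX (Fin N) (Fin N) k).det (GLCoord N k) :=
  inferInstanceAs (IsLocalization.Away (Matrix.mvPolynomialX (Fin N) (Fin N) k).det
    (Localization.Away (Matrix.mvPolynomialX (Fin N) (Fin N) k).det))

/-- The localisation map `O(M_{N,N}) = k[x_{ij}] → O(GL_N)`. -/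
def ofPoly : MvPolynomial (Fin N × Fin N) k →ₐ[k] GLCoord N k :=
  Algebra.algHom k (MvPolynomial (Fin N × Fin N) k) (GLCoord N k)

/-- The matrix `(x_{ij})` over `O(GL_N)`. -/
def gen : Matrix (Fin N) (Fin N) (GLCoord N k) :=
  Matrix.of fun i j => ofPoly N k (MvPolynomial.X (i, j))

theorem gen_eq : gen N k = (ofPoly N k).mapMatrix (Matrix.mvPolynomialX (Fin N) (Fin N) k) := by
  ext i j
  simp [gen, Matrix.mvPolynomialX_apply]

theorem isUnit_det_gen : IsUnit (gen N k).det := by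
  rw [gen_eq, ← AlgHom.map_det]
  exact IsLocalization.Away.algebraMap_isUnit (S := GLCoord N k) _

/-- The determinant, as a unit of `O(GL_N)`. -/
def detUnit : (GLCoord N k)ˣ := (isUnit_det_gen N k).unit

variable {N k} {R : Type*} [CommRing R] [Algebra k R]

/-- An invertible matrix over `R` is an `R`-valued point of `GL_N`. -/
def lift (M : Matrix (Fin N) (Fin N) R) (hM : IsUnit M.det) : GLCoord N k →ₐ[k] R :=
  IsLocalization.Away.liftAlgHom
    (Matrix.mvPolynomialX (Fin N) (Fin N) k).det
    (f := MvPolynomial.aeval fun ij : Fin N × Fin N => M ij.1 ij.2) (by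
      rw [AlgHom.map_det, Matrix.mvPolynomialX_mapMatrix_aeval]
      exact hM)

theorem lift_gen (M : Matrix (Fin N) (Fin N) R) (hM : IsUnit M.det) (i j : Fin N) :
    lift (k := k) M hM (gen N k i j) = M i j := by
  have h : lift (k := k) M hM (gen N k i j) =
      MvPolynomial.aeval (R := k) (fun ij : Fin N × Fin N => M ij.1 ij.2)
        (MvPolynomial.X (i, j)) :=
    IsLocalization.Away.lift_eq (S := GLCoord N k) (Matrix.mvPolynomialX (Fin N) (Fin N) k).det
      (g := (MvPolynomial.aeval fun ij : Fin N × Fin N => M ij.1 ij.2).toRingHom) (by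
        change IsUnit (MvPolynomial.aeval (R := k) (fun ij : Fin N × Fin N => M ij.1 ij.2) _)
        rw [AlgHom.map_det, Matrix.mvPolynomialX_mapMatrix_aeval]
        exact hM) _
  rw [h, MvPolynomial.aeval_X]

theorem lift_mapMatrix (M : Matrix (Fin N) (Fin N) R) (hM : IsUnit M.det) :
    (lift (k := k) M hM).mapMatrix (gen N k) = M := by
  ext i j
  exact lift_gen M hM i j

theorem algHom_ext {f g : GLCoord N k →ₐ[k] R}
    (h : f.mapMatrix (gen N k) = g.mapMatrix (gen N k)) : f = g := by
  refine IsLocalization.algHom_ext (R := k)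
    (Submonoid.powers (Matrix.mvPolynomialX (Fin N) (Fin N) k).det)
    (MvPolynomial.algHom_ext fun ij => ?_)
  exact congrFun (congrFun h ij.1) ij.2

theorem isUnit_det_mapMatrix (f : GLCoord N k →ₐ[k] R) : IsUnit (f.mapMatrix (gen N k)).det := by
  rw [← AlgHom.map_det]
  exact (isUnit_det_gen N k).map f

variable (N k)

/-- The comultiplication `x_{ij} ↦ ∑ₛ x_{is} ⊗ x_{sj}`. -/
def comulHom : GLCoord N k →ₐ[k] GLCoord N k ⊗[k] GLCoord N k :=
  lift ((Algebra.TensorProduct.includeLeft (S := k)).mapMatrix (gen N k) *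
      Algebra.TensorProduct.includeRight.mapMatrix (gen N k)) (by
    rw [Matrix.det_mul]
    exact (isUnit_det_mapMatrix _).mul (isUnit_det_mapMatrix _))

/-- The counit `x_{ij} ↦ δ_{ij}`. -/
def counitHom : GLCoord N k →ₐ[k] k := lift 1 (by simp)

theorem comulHom_gen (i j : Fin N) :
    comulHom N k (gen N k i j) = ∑ s, gen N k i s ⊗ₜ[k] gen N k s j := by
  rw [comulHom, lift_gen, Matrix.mul_apply]
  simp

theorem counitHom_gen (i j : Fin N) :
    counitHom N k (gen N k i j) = (1 : Matrix (Fin N) (Fin N) k) i j := by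
  rw [counitHom, lift_gen]

/-- The antipode `x_{ij} ↦ (x⁻¹)_{ij}`. -/
def antipodeHom : GLCoord N k →ₐ[k] GLCoord N k :=
  lift (gen N k)⁻¹ ((Matrix.isUnit_nonsing_inv_det_iff).2 (isUnit_det_gen N k))

theorem antipodeHom_gen (i j : Fin N) :
    antipodeHom N k (gen N k i j) = (gen N k)⁻¹ i j := by
  rw [antipodeHom, lift_gen]

instance instBialgebra : Bialgebra k (GLCoord N k) :=
  Bialgebra.ofAlgHom (comulHom N k) (counitHom N k)
    (algHom_ext (by
      ext i j
      simp [comulHom_gen, TensorProduct.sum_tmul, TensorProduct.tmul_sum]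
      exact Finset.sum_comm))
    (algHom_ext (by
      ext i j
      simp [comulHom_gen, counitHom_gen, Matrix.one_apply, TensorProduct.ite_tmul]))
    (algHom_ext (by
      ext i j
      simp [comulHom_gen, counitHom_gen, Matrix.one_apply, TensorProduct.tmul_ite]))

instance instHopfAlgebra : HopfAlgebra k (GLCoord N k) :=
  HopfAlgebra.ofAlgHom (antipodeHom N k)
    (algHom_ext (by
      ext i j
      have h := congrFun (congrFun (Matrix.nonsing_inv_mul _ (isUnit_det_gen N k)) i) j
      rw [Matrix.mul_apply] at h
      change Algebra.TensorProduct.lift _ _ (fun _ _ => Commute.all _ _) (comulHom N k (gen N k i j)) =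
        Algebra.ofId k (GLCoord N k) (counitHom N k (gen N k i j))
      rw [comulHom_gen, counitHom_gen, map_sum]
      simp only [Algebra.TensorProduct.lift_tmul, antipodeHom_gen, AlgHom.id_apply]
      rw [h]
      simp [Matrix.one_apply, apply_ite (Algebra.ofId k (GLCoord N k))]))
    (algHom_ext (by
      ext i j
      have h := congrFun (congrFun (Matrix.mul_nonsing_inv _ (isUnit_det_gen N k)) i) j
      rw [Matrix.mul_apply] at h
      change Algebra.TensorProduct.lift _ _ (fun _ _ => Commute.all _ _) (comulHom N k (gen N k i j)) =
        Algebra.ofId k (GLCoord N k) (counitHom N k (gen N k i j))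
      rw [comulHom_gen, counitHom_gen, map_sum]
      simp only [Algebra.TensorProduct.lift_tmul, antipodeHom_gen, AlgHom.id_apply]
      rw [h]
      simp [Matrix.one_apply, apply_ite (Algebra.ofId k (GLCoord N k))]))

/-! ## The filtration by degree -/

/-- `O(G_m)_{≤ d} ⊆ O(G_m) = k[t, t⁻¹]`, the span of the `t^i` with `N * |i| ≤ d`. -/
def torusLE (d : ℕ) : Submodule k k[T;T⁻¹] :=
  Submodule.span k {f | ∃ i : ℤ, N * i.natAbs ≤ d ∧ f = LaurentPolynomial.T i}

/-- `(O(M_{N,N}) ⊗ O(G_m))_{≤ d}`, the sum of the `O(M_{N,N})_{≤ a} ⊗ O(G_m)_{≤ b}` with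
`a + b ≤ d`, where `O(M_{N,N})_{≤ a}` is the space of polynomials of total degree at most `a`. -/
def monoidLE (d : ℕ) : Submodule k (MvPolynomial (Fin N × Fin N) k ⊗[k] k[T;T⁻¹]) :=
  ⨆ (a : ℕ) (b : ℕ) (_ : a + b ≤ d), LinearMap.range (TensorProduct.map
    (MvPolynomial.restrictTotalDegree (Fin N × Fin N) k a).subtype (torusLE N k b).subtype)

/-- The comorphism `O(G_m) → O(GL_N)` of `A ↦ det(A)⁻¹`. -/
def invDet : k[T;T⁻¹] →ₐ[k] GLCoord N k :=
  AddMonoidAlgebra.lift k (GLCoord N k) ℤ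
    ((Units.coeHom (GLCoord N k)).comp (zpowersHom (GLCoord N k)ˣ (detUnit N k)⁻¹))

/-- The comorphism `η^* : O(M_{N,N}) ⊗ O(G_m) → O(GL_N)` of the closed immersion
`η : GL_N → M_{N,N} × G_m`, `A ↦ (A, det(A)⁻¹)`. -/
def etaStar : MvPolynomial (Fin N × Fin N) k ⊗[k] k[T;T⁻¹] →ₐ[k] GLCoord N k :=
  Algebra.TensorProduct.lift (ofPoly N k) (invDet N k) fun _ _ => Commute.all _ _

/-- `O(GL_N)_{≤ d}`, the image of `(O(M_{N,N}) ⊗ O(G_m))_{≤ d}` under `η^*`. -/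
def le (d : ℕ) : Submodule k (GLCoord N k) := (monoidLE N k d).map (etaStar N k).toLinearMap

/-- The image of `O(GL_N)_{≤ d} ⊗ O(GL_N)_{≤ d}` in `O(GL_N) ⊗ O(GL_N)`. -/
def leTensor (d : ℕ) : Submodule k (GLCoord N k ⊗[k] GLCoord N k) :=
  LinearMap.range (TensorProduct.map (le N k d).subtype (le N k d).subtype)

variable {N k}

theorem invDet_T (i : ℤ) : invDet N k (LaurentPolynomial.T i) = ((detUnit N k ^ (-i) : (GLCoord N k)ˣ) : GLCoord N k) := by
  have h : invDet N k (LaurentPolynomial.T i) =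
      ((((detUnit N k)⁻¹ ^ i : (GLCoord N k)ˣ)) : GLCoord N k) := by
    change AddMonoidAlgebra.lift k (GLCoord N k) ℤ _ (AddMonoidAlgebra.single i 1) = _
    rw [AddMonoidAlgebra.lift_single, one_smul]
    rfl
  rw [h, inv_zpow, zpow_neg]

theorem mem_le_of {a b d : ℕ} (h : a + b ≤ d) {f : MvPolynomial (Fin N × Fin N) k}
    (hf : f ∈ MvPolynomial.restrictTotalDegree (Fin N × Fin N) k a) {g : k[T;T⁻¹]}
    (hg : g ∈ torusLE N k b) : ofPoly N k f * invDet N k g ∈ le N k d := by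
  refine ⟨f ⊗ₜ g, ?_, by simp [etaStar]⟩
  refine (le_iSup_of_le a (le_iSup_of_le b (le_iSup_of_le h le_rfl)) :
    LinearMap.range (TensorProduct.map (MvPolynomial.restrictTotalDegree (Fin N × Fin N) k a).subtype
      (torusLE N k b).subtype) ≤ monoidLE N k d)
    ⟨⟨f, hf⟩ ⊗ₜ ⟨g, hg⟩, TensorProduct.map_tmul _ _ _ _⟩

theorem le_induction {d : ℕ} {S : Submodule k (GLCoord N k)}
    (h : ∀ (a b : ℕ), a + b ≤ d →
      ∀ f ∈ MvPolynomial.restrictTotalDegree (Fin N × Fin N) k a, ∀ g ∈ torusLE N k b,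
        ofPoly N k f * invDet N k g ∈ S) : le N k d ≤ S := by
  rw [le, Submodule.map_le_iff_le_comap]
  refine iSup_le fun a => iSup_le fun b => iSup_le fun hab => ?_
  rintro _ ⟨t, rfl⟩
  induction t using TensorProduct.induction_on with
  | zero => simp
  | tmul f g =>
    have := h a b hab f f.2 g g.2
    simpa [etaStar] using this
  | add x y hx hy => rw [map_add]; exact Submodule.add_mem _ hx hy

theorem one_mem_torusLE : (1 : k[T;T⁻¹]) ∈ torusLE N k 0 :=
  Submodule.subset_span ⟨0, by simp, LaurentPolynomial.T_zero.symm⟩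

theorem one_mem_le : (1 : GLCoord N k) ∈ le N k 0 := by
  have := mem_le_of (N := N) (k := k) (le_refl (0 + 0))
    (f := 1) ((MvPolynomial.mem_restrictTotalDegree _ _ _).2 (by simp)) one_mem_torusLE
  simpa using this

theorem gen_mem_le (i j : Fin N) : gen N k i j ∈ le N k 1 := by
  have := mem_le_of (N := N) (k := k) (le_refl (1 + 0))
    (f := MvPolynomial.X (i, j)) ((MvPolynomial.mem_restrictTotalDegree _ _ _).2 (by simp))
    one_mem_torusLE
  rw [map_one, mul_one] at this
  exact this

theorem detUnit_zpow_mem_le (i : ℤ) : ((detUnit N k ^ i : (GLCoord N k)ˣ) : GLCoord N k) ∈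
    le N k (N * i.natAbs) := by
  have := mem_le_of (N := N) (k := k) (d := N * i.natAbs) (a := 0) (b := N * i.natAbs) (by simp)
    (f := 1) ((MvPolynomial.mem_restrictTotalDegree _ _ _).2 (by simp))
    (Submodule.subset_span ⟨-i, by simp, rfl⟩)
  simpa [invDet_T] using this

theorem torusLE_mul {a b : ℕ} {f g : k[T;T⁻¹]} (hf : f ∈ torusLE N k a) (hg : g ∈ torusLE N k b) :
    f * g ∈ torusLE N k (a + b) := by
  have h := Submodule.mul_mem_mul hf hg
  rw [torusLE, torusLE, Submodule.span_mul_span] at h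
  refine Submodule.span_mono ?_ h
  rintro _ ⟨_, ⟨i, hi, rfl⟩, _, ⟨j, hj, rfl⟩, rfl⟩
  refine ⟨i + j, ?_, (LaurentPolynomial.T_add i j).symm⟩
  calc N * (i + j).natAbs ≤ N * (i.natAbs + j.natAbs) :=
        Nat.mul_le_mul_left _ (Int.natAbs_add_le i j)
    _ ≤ a + b := by rw [mul_add]; exact Nat.add_le_add hi hj

theorem mul_mem_le {a b : ℕ} {x y : GLCoord N k} (hx : x ∈ le N k a) (hy : y ∈ le N k b) :
    x * y ∈ le N k (a + b) := by
  have h1 : le N k a ≤ (le N k (a + b)).comap (LinearMap.mulRight k y) := by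
    refine le_induction fun a₁ a₂ ha f hf g hg => ?_
    have h2 : le N k b ≤ (le N k (a + b)).comap
        (LinearMap.mulLeft k (ofPoly N k f * invDet N k g)) := by
      refine le_induction fun b₁ b₂ hb f' hf' g' hg' => ?_
      have h3 : ofPoly N k f * invDet N k g * (ofPoly N k f' * invDet N k g') =
          ofPoly N k (f * f') * invDet N k (g * g') := by
        rw [map_mul, map_mul]; ring
      rw [Submodule.mem_comap, LinearMap.mulLeft_apply, h3]
      refine mem_le_of (a := a₁ + b₁) (b := a₂ + b₂) (by omega) ?_ (torusLE_mul hg hg')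
      rw [MvPolynomial.mem_restrictTotalDegree] at hf hf' ⊢
      exact (MvPolynomial.totalDegree_mul _ _).trans (Nat.add_le_add hf hf')
    have h4 := h2 hy
    rw [Submodule.mem_comap, LinearMap.mulLeft_apply] at h4
    rw [Submodule.mem_comap, LinearMap.mulRight_apply]
    exact h4
  have h5 := h1 hx
  rw [Submodule.mem_comap, LinearMap.mulRight_apply] at h5
  exact h5

theorem le_mono {a b : ℕ} (h : a ≤ b) : le N k a ≤ le N k b :=
  le_induction fun _ _ ha _ hf _ hg => mem_le_of (ha.trans h) hf hg

theorem tmul_mem_leTensor {d : ℕ} {x y : GLCoord N k} (hx : x ∈ le N k d) (hy : y ∈ le N k d) :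
    x ⊗ₜ y ∈ leTensor N k d := ⟨⟨x, hx⟩ ⊗ₜ ⟨y, hy⟩, TensorProduct.map_tmul _ _ _ _⟩

theorem leTensor_mono {a b : ℕ} (h : a ≤ b) : leTensor N k a ≤ leTensor N k b := by
  rintro _ ⟨t, rfl⟩
  induction t using TensorProduct.induction_on with
  | zero => simp
  | tmul x y =>
    rw [TensorProduct.map_tmul]
    exact tmul_mem_leTensor (le_mono h x.2) (le_mono h y.2)
  | add x y hx hy => rw [map_add]; exact Submodule.add_mem _ hx hy

theorem mul_mem_leTensor {a b : ℕ} {x y : GLCoord N k ⊗[k] GLCoord N k}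
    (hx : x ∈ leTensor N k a) (hy : y ∈ leTensor N k b) : x * y ∈ leTensor N k (a + b) := by
  obtain ⟨s, rfl⟩ := hx
  obtain ⟨t, rfl⟩ := hy
  induction s using TensorProduct.induction_on with
  | zero => simp
  | add x y hx hy => rw [map_add, add_mul]; exact Submodule.add_mem _ hx hy
  | tmul x x' =>
    induction t using TensorProduct.induction_on with
    | zero => simp
    | add x y hx hy => rw [map_add, mul_add]; exact Submodule.add_mem _ hx hy
    | tmul y y' =>
      simp only [TensorProduct.map_tmul, Algebra.TensorProduct.tmul_mul_tmul]
      exact tmul_mem_leTensor (mul_mem_le x.2 y.2) (mul_mem_le x'.2 y'.2)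

theorem comulHom_detUnit_zpow (i : ℤ) : comulHom N k ((detUnit N k ^ i : (GLCoord N k)ˣ) : GLCoord N k) =
    ((detUnit N k ^ i : (GLCoord N k)ˣ) : GLCoord N k) ⊗ₜ[k] ((detUnit N k ^ i : (GLCoord N k)ˣ) : GLCoord N k) := by
  have h : Units.map (comulHom N k).toRingHom.toMonoidHom (detUnit N k) =
      Units.map (Algebra.TensorProduct.includeLeft (R := k) (S := k) (A := GLCoord N k)
        (B := GLCoord N k)).toRingHom.toMonoidHom (detUnit N k) *
      Units.map (Algebra.TensorProduct.includeRight (R := k) (A := GLCoord N k)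
        (B := GLCoord N k)).toRingHom.toMonoidHom (detUnit N k) := by
    ext
    change comulHom N k (gen N k).det = Algebra.TensorProduct.includeLeft (gen N k).det *
      Algebra.TensorProduct.includeRight (gen N k).det
    rw [AlgHom.map_det, AlgHom.map_det, AlgHom.map_det, ← Matrix.det_mul, comulHom,
      lift_mapMatrix]
  have h' := congrArg (fun u => ((u ^ i : (GLCoord N k ⊗[k] GLCoord N k)ˣ) : GLCoord N k ⊗[k] GLCoord N k)) h
  simp only [mul_zpow, ← map_zpow] at h'
  refine h'.trans ?_
  rw [Units.val_mul]
  change Algebra.TensorProduct.includeLeft _ * Algebra.TensorProduct.includeRight _ = _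
  rw [Algebra.TensorProduct.includeLeft_apply, Algebra.TensorProduct.includeRight_apply,
    Algebra.TensorProduct.tmul_mul_tmul, one_mul, mul_one]

theorem comulHom_mem_leTensor {d : ℕ} {x : GLCoord N k} (hx : x ∈ le N k d) :
    comulHom N k x ∈ leTensor N k d := by
  have h1 : ∀ m : (Fin N × Fin N) →₀ ℕ, comulHom N k (ofPoly N k (MvPolynomial.monomial m 1)) ∈
      leTensor N k (m.sum fun _ e => e) := by
    intro m
    induction m using Finsupp.induction with
    | zero =>
      have h := tmul_mem_leTensor (one_mem_le (N := N) (k := k)) one_mem_le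
      rw [Finsupp.sum_zero_index, ← MvPolynomial.one_def, map_one, map_one]
      exact h
    | single_add ij n m hij hn ih =>
      have h3 : ∀ n : ℕ, comulHom N k (ofPoly N k (MvPolynomial.X ij ^ n)) ∈ leTensor N k n := by
        intro n
        induction n with
        | zero =>
          rw [pow_zero, map_one, map_one]
          exact tmul_mem_leTensor one_mem_le one_mem_le
        | succ n ih =>
          rw [pow_succ, map_mul, map_mul]
          refine mul_mem_leTensor ih ?_
          have h4 := comulHom_gen N k ij.1 ij.2
          change comulHom N k (ofPoly N k (MvPolynomial.X ij)) = _ at h4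
          rw [h4]
          exact Submodule.sum_mem _ fun s _ => tmul_mem_leTensor (gen_mem_le _ _) (gen_mem_le _ _)
      have h5 : MvPolynomial.monomial (Finsupp.single ij n + m) (1 : k) =
          MvPolynomial.X ij ^ n * MvPolynomial.monomial m 1 := by
        rw [MvPolynomial.X_pow_eq_monomial, MvPolynomial.monomial_mul, one_mul]
      rw [h5, map_mul, map_mul, Finsupp.sum_add_index' (fun _ => rfl) (fun _ _ _ => rfl),
        Finsupp.sum_single_index rfl]
      exact mul_mem_leTensor (h3 n) ih
  have h2 : ∀ a, ∀ f ∈ MvPolynomial.restrictTotalDegree (Fin N × Fin N) k a,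
      comulHom N k (ofPoly N k f) ∈ leTensor N k a := by
    intro a f hf
    rw [MvPolynomial.mem_restrictTotalDegree] at hf
    rw [f.as_sum, map_sum, map_sum]
    refine Submodule.sum_mem _ fun m hm => ?_
    have h3 : MvPolynomial.monomial m (f.coeff m) =
        f.coeff m • MvPolynomial.monomial m (1 : k) := by
      rw [MvPolynomial.smul_monomial, smul_eq_mul, mul_one]
    rw [h3, map_smul, map_smul]
    exact Submodule.smul_mem _ _
      (leTensor_mono ((MvPolynomial.le_totalDegree hm).trans hf) (h1 m))
  have h3 : ∀ b, ∀ g ∈ torusLE N k b, comulHom N k (invDet N k g) ∈ leTensor N k b := by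
    intro b g hg
    suffices h : torusLE N k b ≤ (leTensor N k b).comap
        ((comulHom N k).comp (invDet N k)).toLinearMap from h hg
    refine Submodule.span_le.2 ?_
    rintro _ ⟨i, hi, rfl⟩
    have h4 : ((detUnit N k ^ (-i) : (GLCoord N k)ˣ) : GLCoord N k) ∈ le N k b :=
      le_mono (by simpa using hi) (detUnit_zpow_mem_le (-i))
    change comulHom N k (invDet N k (LaurentPolynomial.T i)) ∈ leTensor N k b
    rw [invDet_T, comulHom_detUnit_zpow]
    exact tmul_mem_leTensor h4 h4
  suffices h : le N k d ≤ (leTensor N k d).comap (comulHom N k).toLinearMap from h hx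
  refine le_induction fun a b hab f hf g hg => ?_
  change comulHom N k (ofPoly N k f * invDet N k g) ∈ leTensor N k d
  rw [map_mul]
  exact leTensor_mono hab (mul_mem_leTensor (h2 a f hf) (h3 b g hg))

end GLCoord

section Filtration

variable {k A : Type u} [Field k] [CommRing A] [HopfAlgebra k A] {N : ℕ}

/-- `O(G)_{≤ d, φ} = φ^*(O(GL_N)_{≤ d})` for a homomorphism `φ : G → GL_N` with comorphism
`φ^* : O(GL_N) → O(G) = A`. -/
def coordLE (φ : GLCoord N k →ₐc[k] A) (d : ℕ) : Submodule k A :=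
  (GLCoord.le N k d).map (φ : GLCoord N k →ₐ[k] A).toLinearMap

instance coordLE_isSubcoalgebra (φ : GLCoord N k →ₐc[k] A) (d : ℕ) :
    (coordLE φ d).IsSubcoalgebra where
  comul_mem := by
    rintro _ ⟨x, hx, rfl⟩
    obtain ⟨t, ht⟩ := GLCoord.comulHom_mem_leTensor hx
    have h1 : (Coalgebra.comul (φ x) : A ⊗[k] A) =
        TensorProduct.map (φ : GLCoord N k →ₐ[k] A).toLinearMap
          (φ : GLCoord N k →ₐ[k] A).toLinearMap (GLCoord.comulHom N k x) :=
      (CoalgHomClass.map_comp_comul_apply φ x).symm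
    change (Coalgebra.comul (φ x) : A ⊗[k] A) ∈ _
    rw [h1, ← ht]
    clear h1 ht
    induction t using TensorProduct.induction_on with
    | zero => simp
    | add x y hx hy => rw [map_add, map_add]; exact Submodule.add_mem _ hx hy
    | tmul a b => exact ⟨⟨_, ⟨a, a.2, rfl⟩⟩ ⊗ₜ ⟨_, ⟨b, b.2, rfl⟩⟩, by
        simp only [TensorProduct.map_tmul, Submodule.subtype_apply]⟩

end Filtration

/-! ## Frobenius kernels -/

section Frobenius

variable (k A : Type u) [Field k] [CommRing A] [HopfAlgebra k A] (p r : ℕ)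

/-- The ideal of `O(G) = A` that defines the `r`-th Frobenius kernel `G_(r)`, the kernel of
`F^r : G → G^(r)`.  It is generated by the `f ^ (p ^ r)` with `f` in the augmentation ideal. -/
def frobeniusIdeal : Ideal A :=
  Ideal.span {x | ∃ f : A, Coalgebra.counit (R := k) f = 0 ∧ x = f ^ p ^ r}

variable [Fact p.Prime] [CharP k p]

/-- An `R`-valued point `g : O(G) → R` of `G` lies in the Frobenius kernel if and only if
`f ↦ g(f) ^ (p ^ r)`, which is `F^r(g)`, is the unit element `f ↦ ε(f) ^ (p ^ r)`. -/
theorem frobeniusIdeal_le_ker_iff {R : Type*} [CommRing R] [Algebra k R] (g : A →ₐ[k] R) :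
    frobeniusIdeal k A p r ≤ RingHom.ker g ↔
      ∀ f : A, g f ^ p ^ r = algebraMap k R (Coalgebra.counit f) ^ p ^ r := by
  have hp : ∀ x y : R, (x - y) ^ p ^ r = x ^ p ^ r - y ^ p ^ r := by
    intro x y
    cases subsingleton_or_nontrivial R
    · exact Subsingleton.elim _ _
    · have : CharP R p := charP_of_injective_algebraMap (algebraMap k R).injective p
      exact sub_pow_char_pow x y r
  constructor
  · intro h f
    have h1 : (f - algebraMap k A (Coalgebra.counit f)) ^ p ^ r ∈ frobeniusIdeal k A p r :=
      Ideal.subset_span ⟨_, by simp, rfl⟩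
    have h2 := h h1
    rw [RingHom.mem_ker, map_pow, map_sub, AlgHom.commutes, hp, sub_eq_zero] at h2
    exact h2
  · intro h
    refine Ideal.span_le.2 ?_
    rintro _ ⟨f, hf, rfl⟩
    have := h f
    rw [hf, map_zero, zero_pow (pow_ne_zero _ (Fact.out : p.Prime).ne_zero)] at this
    change g (f ^ p ^ r) = 0
    rw [map_pow, this]

instance frobeniusIdeal_isHopfIdeal : (frobeniusIdeal k A p r).IsHopfIdeal k where
  counit_eq_zero := by
    intro x hx
    have h := (frobeniusIdeal_le_ker_iff k A p r (Bialgebra.counitAlgHom k A)).2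
      (fun f => by simp)
    exact h hx
  map_mkQ_comul_eq_zero := by
    intro x hx
    let I := frobeniusIdeal k A p r
    let q : A →ₐ[k] A ⧸ I := Ideal.Quotient.mkₐ k I
    have hq : ∀ f : A, q f ^ p ^ r = algebraMap k (A ⧸ I) (Coalgebra.counit f) ^ p ^ r :=
      (frobeniusIdeal_le_ker_iff k A p r q).1 fun x hx => Ideal.Quotient.eq_zero_iff_mem.2 hx
    let g : A →ₐ[k] (A ⧸ I) ⊗[k] (A ⧸ I) :=
      (Algebra.TensorProduct.map q q).comp (Bialgebra.comulAlgHom k A)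
    have hp : ∀ x y : (A ⧸ I) ⊗[k] (A ⧸ I), (x + y) ^ p ^ r = x ^ p ^ r + y ^ p ^ r := by
      intro x y
      cases subsingleton_or_nontrivial ((A ⧸ I) ⊗[k] (A ⧸ I))
      · exact Subsingleton.elim _ _
      · have : CharP ((A ⧸ I) ⊗[k] (A ⧸ I)) p :=
          charP_of_injective_algebraMap (algebraMap k _).injective p
        exact add_pow_char_pow x y p r
    have h1 : ∀ t : A ⊗[k] A, Algebra.TensorProduct.map q q t ^ p ^ r =
        algebraMap k ((A ⧸ I) ⊗[k] (A ⧸ I))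
          (TensorProduct.lid k k (TensorProduct.map Coalgebra.counit Coalgebra.counit t)) ^
            p ^ r := by
      intro t
      induction t using TensorProduct.induction_on with
      | zero => simp
      | tmul a b =>
        rw [Algebra.TensorProduct.map_tmul, Algebra.TensorProduct.tmul_pow, hq, hq,
          ← Algebra.TensorProduct.tmul_pow, TensorProduct.map_tmul, TensorProduct.lid_tmul,
          smul_eq_mul, map_mul]
        congr 1
        rw [Algebra.algebraMap_eq_smul_one, Algebra.algebraMap_eq_smul_one,
          TensorProduct.smul_tmul_smul, Algebra.algebraMap_eq_smul_one,
          Algebra.algebraMap_eq_smul_one, smul_mul_smul_comm, mul_one,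
          Algebra.TensorProduct.one_def]
      | add x y hx hy => rw [map_add, hp, hx, hy, map_add, map_add, map_add, hp]
    have h2 : ∀ f : A, TensorProduct.lid k k
        (TensorProduct.map Coalgebra.counit Coalgebra.counit (Coalgebra.comul f)) =
          Coalgebra.counit (R := k) f := by
      intro f
      have h3 : TensorProduct.map (Coalgebra.counit (R := k) (A := A)) Coalgebra.counit
          (Coalgebra.comul f) = Coalgebra.counit.lTensor k
            (Coalgebra.counit.rTensor A (Coalgebra.comul f)) := by
        rw [← LinearMap.comp_apply (Coalgebra.counit.lTensor k), LinearMap.lTensor_comp_rTensor]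
      rw [h3, Coalgebra.rTensor_counit_comul]
      simp
    have h := (frobeniusIdeal_le_ker_iff k A p r g).2 (fun f => by
      rw [← h2 f]; exact h1 (Coalgebra.comul f))
    exact h hx
  antipode_mem := by
    intro x hx
    have hq := (frobeniusIdeal_le_ker_iff k A p r
      (Ideal.Quotient.mkₐ k (frobeniusIdeal k A p r))).1 fun x hx => Ideal.Quotient.eq_zero_iff_mem.2 hx
    have h := (frobeniusIdeal_le_ker_iff k A p r ((Ideal.Quotient.mkₐ k
      (frobeniusIdeal k A p r)).comp (HopfAlgebra.antipodeAlgHom k A))).2 (fun f =>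
        (hq (HopfAlgebra.antipode k f)).trans (by rw [HopfAlgebra.counit_antipode]))
    exact Ideal.Quotient.eq_zero_iff_mem.1 (h hx)

/-- The coordinate algebra `O(G_(r))` of the Frobenius kernel `G_(r)`, the quotient Hopf algebra of
`O(G) = A` by `frobeniusIdeal`. -/
def FrobeniusKernel : Type u := A ⧸ frobeniusIdeal k A p r

instance FrobeniusKernel.instCommRing : CommRing (FrobeniusKernel k A p r) :=
  inferInstanceAs (CommRing (A ⧸ frobeniusIdeal k A p r))

instance FrobeniusKernel.instHopfAlgebra : HopfAlgebra k (FrobeniusKernel k A p r) :=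
  inferInstanceAs (HopfAlgebra k (A ⧸ frobeniusIdeal k A p r))

/-- The comorphism `O(G) → O(G_(r))` of the inclusion `G_(r) → G`. -/
def toFrobeniusKernel : A →ₗc[k] FrobeniusKernel k A p r :=
  (Bialgebra.Quotient.mkBialgHom (R := k) (frobeniusIdeal k A p r)).toCoalgHom

end Frobenius

/-! ## The functors -/

section Functors

variable {k A : Type u} [Field k] [CommRing A] [HopfAlgebra k A]

/-- The inclusion functor `i_{≤ d, φ} : CoMod(O(G)_{≤ d, φ}) → Mod(G)`. -/
abbrev inclusionLE {N : ℕ} (φ : GLCoord N k →ₐc[k] A) (d : ℕ) :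
    Comod k (coordLE φ d) ⥤ Comod k A :=
  Comod.pushforward (Subcoalgebra.incl (coordLE φ d))

/-- The functor `(-)_{≤ d, φ} : Mod(G) → CoMod(O(G)_{≤ d, φ})`. -/
abbrev truncationLE {N : ℕ} (φ : GLCoord N k →ₐc[k] A) (d : ℕ) :
    Comod k A ⥤ Comod k (coordLE φ d) :=
  Comod.truncation (coordLE φ d)

variable (k A) (p r : ℕ) [Fact p.Prime] [CharP k p]

/-- The restriction functor `Mod(G) → Mod(G_(r))`. -/
abbrev restrictionFrobenius : Comod k A ⥤ Comod k (FrobeniusKernel k A p r) :=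
  Comod.pushforward (toFrobeniusKernel k A p r)

/-- The induction functor `ind_{G_(r)}^G : Mod(G_(r)) → Mod(G)`. -/
abbrev inductionFrobenius : Comod k (FrobeniusKernel k A p r) ⥤ Comod k A :=
  Comod.induction (toFrobeniusKernel k A p r)

end Functors

end

/-!
The two adjoint pairs behind the theorem hold for arbitrary coalgebras over a field.

For a subcoalgebra `X ⊆ C`, a homomorphism from an `X`-comodule `V` to a `C`-comodule `M` has as its
image an `X`-subcomodule of `M`, so it factors through the largest one, `M_X`.  Hence `M ↦ M_X` is
right adjoint to the inclusion of `X`-comodules into `C`-comodules (`Comod.truncationAdj`).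

For a homomorphism of coalgebras `g : C → D`, induction along `g` is right adjoint to restriction of
the coaction along `g` (`Comod.inductionAdj`, Frobenius reciprocity).  A linear map `u : M → N`
corresponds to the homomorphism of `C`-comodules `m ↦ (u ⊗ id)(Δ_M(m))` into the cofree comodule
`N ⊗ C`, with inverse `F ↦ (id ⊗ ε) ∘ F`, and `u` is a homomorphism of `D`-comodules exactly when the
values lie in the cotensor product of `N` and `C` over `D`.

The composite of the two adjunctions, for `X = O(G)_{≤ d, φ}` and `g : O(G) → O(G_(r))`, is the
adjunction of the theorem.  A right adjoint preserves limits and a left adjoint preserves colimits,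
which leaves the preservation of finite limits by the left adjoint.  Comodules over `C` are the
coalgebras for the comonad `- ⊗ C` on vector spaces, which is exact because vector spaces are flat;
so the forgetful functor to vector spaces creates finite limits.  As the restriction of coactions
does not change the underlying vector spaces, it preserves them
(`Comod.pushforward_preservesFiniteLimits`).
-/

noncomputable section

namespace Comod

/-! ### Homomorphisms into a restricted comodule -/

section Restrict

variable {k C D : Type u} [Field k] [AddCommGroup C] [Module k C] [Coalgebra k C]
  [AddCommGroup D] [Module k D] [Coalgebra k D]

/-- A linear map `f : V → M` with values in `N ⊆ M` and `Δ_M ∘ f = (f ⊗ j) ∘ Δ_V`, as a homomorphism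
of `D`-comodules into `N`. -/
def restrictLift (j : D →ₗc[k] C) (hj : Function.Injective j.toLinearMap) {M : Comod k C}
    (N : Submodule k M.carrier)
    (hN : ∀ n : N, M.coact n ∈ LinearMap.range (TensorProduct.map N.subtype j.toLinearMap))
    {V : Comod k D} (f : V.carrier →ₗ[k] M.carrier)
    (hf : M.coact ∘ₗ f = TensorProduct.map f j.toLinearMap ∘ₗ V.coact) (hfN : ∀ v, f v ∈ N) :
    V ⟶ restrict j hj M N hN where
  toLinearMap := f.codRestrict N hfN
  comm := by
    refine LinearMap.ext fun v => tensorMap_injective N.injective_subtype hj ?_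
    have h := DFunLike.congr_fun (restrict_coact j hj M N hN) (f.codRestrict N hfN v)
    have h1 : TensorProduct.map f j.toLinearMap = TensorProduct.map N.subtype j.toLinearMap ∘ₗ
        (f.codRestrict N hfN).rTensor D := TensorProduct.ext' fun v d => by simp
    refine h.trans ((DFunLike.congr_fun hf v).trans ?_)
    rw [h1]
    rfl

/-- The underlying map of a homomorphism into `restrict j hj M N hN`, as a linear map into `M`. -/
def toAmbient {j : D →ₗc[k] C} {hj : Function.Injective j.toLinearMap} {M : Comod k C}
    {N : Submodule k M.carrier}
    {hN : ∀ n : N, M.coact n ∈ LinearMap.range (TensorProduct.map N.subtype j.toLinearMap)}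
    {V : Comod k D} (f : V ⟶ restrict j hj M N hN) : V.carrier →ₗ[k] M.carrier :=
  N.subtype ∘ₗ Hom.toLinearMap f

theorem coact_comp_toAmbient {j : D →ₗc[k] C} {hj : Function.Injective j.toLinearMap}
    {M : Comod k C} {N : Submodule k M.carrier}
    {hN : ∀ n : N, M.coact n ∈ LinearMap.range (TensorProduct.map N.subtype j.toLinearMap)}
    {V : Comod k D} (f : V ⟶ restrict j hj M N hN) :
    M.coact ∘ₗ toAmbient f = TensorProduct.map (toAmbient f) j.toLinearMap ∘ₗ V.coact := by
  let f' : V.carrier →ₗ[k] N := Hom.toLinearMap f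
  have h1 : TensorProduct.map (N.subtype ∘ₗ f') j.toLinearMap =
      TensorProduct.map N.subtype j.toLinearMap ∘ₗ f'.rTensor D :=
    TensorProduct.ext' fun v d => by simp
  refine LinearMap.ext fun v => ?_
  refine (DFunLike.congr_fun (restrict_coact j hj M N hN) (f' v)).symm.trans ?_
  refine Eq.trans ?_ (DFunLike.congr_fun h1 (V.coact v)).symm
  exact congrArg (TensorProduct.map N.subtype j.toLinearMap) (DFunLike.congr_fun (Hom.comm f) v)

end Restrict

/-! ### Truncation is right adjoint to inclusion -/

section Truncation

variable {k C : Type u} [Field k] [AddCommGroup C] [Module k C] [Coalgebra k C]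

theorem map_incl_eq (X : Submodule k C) [X.IsSubcoalgebra] {V W : Type u} [AddCommGroup V]
    [Module k V] [AddCommGroup W] [Module k W] (f : V →ₗ[k] W) :
    TensorProduct.map f X.subtype = f.rTensor C ∘ₗ X.subtype.lTensor V :=
  TensorProduct.ext' fun v x => by simp

/-- The image of an `X`-comodule under a homomorphism of `C`-comodules is an `X`-subcomodule, hence
lies in the largest one. -/
theorem mem_largest (X : Submodule k C) [X.IsSubcoalgebra] {V : Comod k X} {M : Comod k C}
    (f : (pushforward (Subcoalgebra.incl X)).obj V ⟶ M) (v : V.carrier) :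
    Hom.toLinearMap f v ∈ largest X M := by
  let f' : V.carrier →ₗ[k] M.carrier := Hom.toLinearMap f
  have h : IsSubcomoduleIn X M (LinearMap.range f') := by
    rintro _ ⟨v, rfl⟩
    refine ⟨f'.rangeRestrict.rTensor X (V.coact v), ?_⟩
    refine Eq.trans ?_ (DFunLike.congr_fun (Hom.comm f) v).symm
    change _ = (f'.rTensor C ∘ₗ X.subtype.lTensor V.carrier) (V.coact v)
    rw [← map_incl_eq, ← LinearMap.comp_apply]
    congr 1
    exact TensorProduct.ext' fun v x => by simp
  exact (le_sSup h : _ ≤ largest X M) ⟨v, rfl⟩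

/-- For a subcoalgebra `X` of `C`, the functor `M ↦ M_X` is right adjoint to the inclusion of
`X`-comodules into `C`-comodules. -/
def truncationAdj (X : Submodule k C) [X.IsSubcoalgebra] :
    pushforward (Subcoalgebra.incl X) ⊣ truncation X :=
  Adjunction.mkOfHomEquiv
    { homEquiv := fun V M =>
        { toFun := fun f => restrictLift (Subcoalgebra.incl X) X.injective_subtype (largest X M)
            (fun n => largest_isSubcomoduleIn X M n n.2) (Hom.toLinearMap f)
            ((Hom.comm f).trans (congrArg (· ∘ₗ V.coact) (map_incl_eq X _).symm))
            (mem_largest X f)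
          invFun := fun f =>
            let F := toAmbient (hj := X.injective_subtype) (V := V) (M := M) f
            ⟨F, (coact_comp_toAmbient (hj := X.injective_subtype) (V := V) (M := M) f).trans
              (congrArg (· ∘ₗ V.coact) (map_incl_eq X F))⟩
          left_inv := fun _ => rfl
          right_inv := fun _ => rfl }
      homEquiv_naturality_left_symm := fun _ _ => rfl
      homEquiv_naturality_right := fun _ _ => rfl }

end Truncation

/-! ### Induction is right adjoint to restriction -/

section Induction

variable {k C D : Type u} [Field k] [AddCommGroup C] [Module k C] [Coalgebra k C]
  [AddCommGroup D] [Module k D] [Coalgebra k D]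

/-- The map `v ⊗ c ↦ ε(c) v`; for `C = O(G)` it is the evaluation of a morphism `G → V` at the
identity element. -/
def evalCounit (C : Type u) [AddCommGroup C] [Module k C] [Coalgebra k C]
    (V : Type u) [AddCommGroup V] [Module k V] : V ⊗[k] C →ₗ[k] V :=
  (TensorProduct.rid k V).toLinearMap ∘ₗ Coalgebra.counit.lTensor V

@[simp]
theorem evalCounit_tmul {V : Type u} [AddCommGroup V] [Module k V] (v : V) (c : C) :
    evalCounit C V (v ⊗ₜ[k] c) = Coalgebra.counit (R := k) c • v := by
  simp [evalCounit]

theorem evalCounit_rTensor {V W : Type u} [AddCommGroup V] [Module k V] [AddCommGroup W]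
    [Module k W] (f : V →ₗ[k] W) (t : V ⊗[k] C) :
    evalCounit C W (f.rTensor C t) = f (evalCounit C V t) := by
  induction t using TensorProduct.induction_on with
  | zero => simp
  | tmul v c => simp
  | add x y hx hy => simp only [map_add, hx, hy]

theorem evalCounit_coact (M : Comod k C) (m : M.carrier) :
    evalCounit C M.carrier (M.coact m) = m :=
  DFunLike.congr_fun M.counit m

/-- `(id ⊗ ε ⊗ id) ∘ (id ⊗ Δ) = id`, the counit axiom on the left. -/
theorem evalCounit_rTensor_coact_cofree {V : Type u} [AddCommGroup V] [Module k V]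
    (t : V ⊗[k] C) : (evalCounit C V).rTensor C ((cofree C V).coact t) = t := by
  have h1 : ∀ (v : V) (s : C ⊗[k] C),
      (evalCounit C V).rTensor C ((TensorProduct.assoc k V C C).symm (v ⊗ₜ s)) =
        v ⊗ₜ TensorProduct.lid k C (Coalgebra.counit.rTensor C s) := by
    intro v s
    induction s using TensorProduct.induction_on with
    | zero => simp
    | tmul a b => simp [TensorProduct.smul_tmul]
    | add x y hx hy => simp only [TensorProduct.tmul_add, map_add, hx, hy]
  refine DFunLike.congr_fun (f := (evalCounit C V).rTensor C ∘ₗ (cofree C V).coact)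
    (g := LinearMap.id) (TensorProduct.ext' fun v c => ?_) t
  exact (h1 v _).trans (by simp; rfl)

/-- A linear map `F : M → V ⊗ C` that is a homomorphism of comodules into the cofree comodule is
determined by its composite with `v ⊗ c ↦ ε(c) v`. -/
theorem rTensor_evalCounit_comp {M : Comod k C} {V : Type u} [AddCommGroup V] [Module k V]
    (F : M.carrier →ₗ[k] V ⊗[k] C) (hF : (cofree C V).coact ∘ₗ F = F.rTensor C ∘ₗ M.coact) :
    (evalCounit C V ∘ₗ F).rTensor C ∘ₗ M.coact = F := by
  rw [LinearMap.rTensor_comp, LinearMap.comp_assoc, ← hF]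
  exact LinearMap.ext fun m => evalCounit_rTensor_coact_cofree (F m)

/-- Coassociativity of the coaction of `M`: it is a homomorphism into the cofree comodule. -/
theorem coact_cofree_comp_coact (M : Comod k C) :
    (cofree C M.carrier).coact ∘ₗ M.coact = M.coact.rTensor C ∘ₗ M.coact := by
  refine LinearMap.ext fun m => ?_
  have h := DFunLike.congr_fun M.coassoc m
  exact (LinearEquiv.symm_apply_eq (TensorProduct.assoc k M.carrier C C)).2 h.symm

/-- For a linear map `u : M → V`, the map `m ↦ (u ⊗ id)(Δ_M(m))` is a homomorphism of comodules into
the cofree comodule `V ⊗ C`. -/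
theorem coact_cofree_comp_rTensor (M : Comod k C) {V : Type u} [AddCommGroup V] [Module k V]
    (u : M.carrier →ₗ[k] V) :
    (cofree C V).coact ∘ₗ u.rTensor C ∘ₗ M.coact =
      (u.rTensor C ∘ₗ M.coact).rTensor C ∘ₗ M.coact := by
  rw [LinearMap.rTensor_comp, LinearMap.comp_assoc, ← coact_cofree_comp_coact]
  exact congrArg (· ∘ₗ M.coact) (Hom.comm (cofreeMap (C := C) u))

/-- A homomorphism `u` of `D`-comodules on `M` gives the homomorphism `m ↦ (u ⊗ id)(Δ_M(m))` into
the cotensor product. -/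
theorem rTensor_coact_mem_cotensor (g : C →ₗc[k] D) {M : Comod k C} {N : Comod k D}
    (u : (pushforward g).obj M ⟶ N) (m : M.carrier) :
    LinearMap.rTensor C (Hom.toLinearMap u : M.carrier →ₗ[k] N.carrier) (M.coact m) ∈
      cotensor g N := by
  let u' : M.carrier →ₗ[k] N.carrier := Hom.toLinearMap u
  have hu : N.coact ∘ₗ u' = TensorProduct.map u' g.toLinearMap ∘ₗ M.coact := by
    refine (Hom.comm u).trans ?_
    change u'.rTensor D ∘ₗ g.toLinearMap.lTensor M.carrier ∘ₗ M.coact = _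
    rw [← LinearMap.comp_assoc, LinearMap.rTensor_comp_lTensor]
  have hL : ∀ t : M.carrier ⊗[k] C, cotensorLeft C N (u'.rTensor C t) =
      TensorProduct.map u' (g.toLinearMap.rTensor C)
        (TensorProduct.assoc k M.carrier C C (M.coact.rTensor C t)) := by
    have h1 : ∀ (s : M.carrier ⊗[k] C) (c : C),
        TensorProduct.assoc k N.carrier D C (TensorProduct.map u' g.toLinearMap s ⊗ₜ c) =
          TensorProduct.map u' (g.toLinearMap.rTensor C)
            (TensorProduct.assoc k M.carrier C C (s ⊗ₜ c)) := by
      intro s c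
      induction s using TensorProduct.induction_on with
      | zero => simp
      | tmul => simp
      | add x y hx hy => simp only [TensorProduct.add_tmul, map_add, hx, hy]
    intro t
    induction t using TensorProduct.induction_on with
    | zero => simp
    | tmul m c =>
      have h := DFunLike.congr_fun hu m
      simp only [LinearMap.comp_apply] at h
      simp only [cotensorLeft, LinearMap.comp_apply, LinearEquiv.coe_coe, LinearMap.rTensor_tmul,
        h, h1]
    | add x y hx hy => simp only [map_add, hx, hy]
  have hR : ∀ t : M.carrier ⊗[k] C, cotensorRight g N (u'.rTensor C t) =
      TensorProduct.map u' (g.toLinearMap.rTensor C) (Coalgebra.comul.lTensor M.carrier t) := by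
    intro t
    induction t using TensorProduct.induction_on with
    | zero => simp
    | tmul m c => simp [cotensorRight]
    | add x y hx hy => simp only [map_add, hx, hy]
  change cotensorLeft C N (u'.rTensor C (M.coact m)) = cotensorRight g N (u'.rTensor C (M.coact m))
  rw [hL, hR]
  exact congrArg _ (DFunLike.congr_fun M.coassoc m)

/-- On the cotensor product, `v ⊗ c ↦ ε(c) v` intertwines the coaction of `N` with `id ⊗ g`. -/
theorem coact_evalCounit (g : C →ₗc[k] D) (N : Comod k D) {x : N.carrier ⊗[k] C}
    (hx : x ∈ cotensor g N) :
    N.coact (evalCounit C N.carrier x) = g.toLinearMap.lTensor N.carrier x := by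
  -- Both sides come from the two maps that define the cotensor product by applying the counit
  -- to the last factor.
  let E : N.carrier ⊗[k] (D ⊗[k] C) →ₗ[k] N.carrier ⊗[k] D :=
    (evalCounit C D).lTensor N.carrier
  have hL : ∀ x, E (cotensorLeft C N x) = N.coact (evalCounit C N.carrier x) := by
    have h1 : ∀ (s : N.carrier ⊗[k] D) (c : C),
        E (TensorProduct.assoc k N.carrier D C (s ⊗ₜ c)) =
          Coalgebra.counit (R := k) c • s := by
      intro s c
      induction s using TensorProduct.induction_on with
      | zero => simp
      | tmul => simp [E]
      | add x y hx hy => simp only [TensorProduct.add_tmul, map_add, smul_add, hx, hy]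
    intro x
    induction x using TensorProduct.induction_on with
    | zero => simp
    | tmul n c => simp [cotensorLeft, h1]
    | add x y hx hy => simp only [map_add, hx, hy]
  have hR : ∀ x, E (cotensorRight g N x) = g.toLinearMap.lTensor N.carrier x := by
    have h1 : ∀ c : C, evalCounit C D (g.toLinearMap.rTensor C (Coalgebra.comul c)) =
        g.toLinearMap c := fun c => by
      rw [evalCounit_rTensor]
      simp [evalCounit]
    intro x
    induction x using TensorProduct.induction_on with
    | zero => simp
    | tmul n c => simp only [cotensorRight, E, LinearMap.lTensor_tmul, LinearMap.comp_apply, h1]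
    | add x y hx hy => simp only [map_add, hx, hy]
  rw [← hL, ← hR]
  exact congrArg E hx

/-- If a homomorphism `F : M → N ⊗ C` into the cofree comodule has values in the cotensor product,
then `(id ⊗ ε) ∘ F` is a homomorphism of `D`-comodules. -/
theorem coact_comp_evalCounit (g : C →ₗc[k] D) {M : Comod k C} {N : Comod k D}
    (F : M.carrier →ₗ[k] N.carrier ⊗[k] C)
    (hF : (cofree C N.carrier).coact ∘ₗ F = F.rTensor C ∘ₗ M.coact)
    (hFN : ∀ m, F m ∈ cotensor g N) :
    N.coact ∘ₗ evalCounit C N.carrier ∘ₗ F =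
      (evalCounit C N.carrier ∘ₗ F).rTensor D ∘ₗ g.toLinearMap.lTensor M.carrier ∘ₗ M.coact := by
  rw [← LinearMap.comp_assoc, ← LinearMap.comp_assoc _ (g.toLinearMap.lTensor M.carrier),
    LinearMap.rTensor_comp_lTensor, ← LinearMap.lTensor_comp_rTensor, LinearMap.comp_assoc,
    LinearMap.comp_assoc, rTensor_evalCounit_comp F hF]
  exact LinearMap.ext fun m => coact_evalCounit g N (hFN m)

/-- Frobenius reciprocity: induction along a homomorphism of coalgebras `g : C → D` is right
adjoint to `pushforward g`.  The adjunct of `u : M → N` is `m ↦ (u ⊗ id)(Δ_M(m))`, and the adjunct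
of `F : M → N ⊗ C` is `(id ⊗ ε) ∘ F`. -/
def inductionAdj (g : C →ₗc[k] D) : pushforward g ⊣ induction g :=
  Adjunction.mkOfHomEquiv
    { homEquiv := fun M N =>
        { toFun := fun u => restrictLift (M := cofree C N.carrier) (CoalgHom.id k C)
            Function.injective_id (cotensor g N) (cotensor_coact_mem g N)
            (LinearMap.rTensor C (Hom.toLinearMap u : M.carrier →ₗ[k] N.carrier) ∘ₗ M.coact)
            (coact_cofree_comp_rTensor M _) (rTensor_coact_mem_cotensor g u)
          invFun := fun f => ⟨evalCounit C N.carrier ∘ₗ toAmbient f,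
            coact_comp_evalCounit g (toAmbient f) (coact_comp_toAmbient f)
              fun m => (Hom.toLinearMap f m).2⟩
          left_inv := fun _ => Hom.ext <| LinearMap.ext fun m =>
            (evalCounit_rTensor _ _).trans (congrArg _ (evalCounit_coact M m))
          right_inv := fun f => Hom.ext <| LinearMap.ext fun m => Subtype.ext <|
            DFunLike.congr_fun (rTensor_evalCounit_comp (toAmbient f) (coact_comp_toAmbient f)) m }
      homEquiv_naturality_left_symm := fun _ _ => rfl
      homEquiv_naturality_right := fun u v => Hom.ext <| LinearMap.ext fun _ =>
        Subtype.ext <| LinearMap.rTensor_comp_apply C (Hom.toLinearMap v) (Hom.toLinearMap u) _ }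

end Induction

/-! ### Finite limits of comodules -/

section Limits

open Limits MonoidalCategory

variable {k : Type u} [Field k]

/-- The comonad `V ↦ V ⊗ C` on vector spaces; its coalgebras are the right `C`-comodules. -/
def tensorComonad (k C : Type u) [Field k] [AddCommGroup C] [Module k C] [Coalgebra k C] :
    Comonad (ModuleCat.{u} k) where
  toFunctor := tensorRight (ModuleCat.of k C)
  ε :=
    { app := fun V => ModuleCat.ofHom (evalCounit C V)
      naturality := fun _ _ f => ModuleCat.hom_ext <| LinearMap.ext fun t =>
        evalCounit_rTensor f.hom t }
  δ :=
    { app := fun V => ModuleCat.ofHom (cofree C V).coact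
      naturality := fun _ _ f => ModuleCat.hom_ext (cofreeMap f.hom).comm }
  coassoc := fun V => ModuleCat.hom_ext (coact_cofree_comp_coact (cofree C V)).symm
  left_counit := fun V => ModuleCat.hom_ext (cofree C V).counit
  right_counit := fun _ => ModuleCat.hom_ext <| LinearMap.ext evalCounit_rTensor_coact_cofree

variable (k) (C : Type u) [AddCommGroup C] [Module k C] [Coalgebra k C]

/-- Comodules over `C`, as coalgebras for the comonad `V ↦ V ⊗ C`. -/
def toCoalgebra : Comod k C ⥤ (tensorComonad k C).Coalgebra where
  obj M :=
    { A := ModuleCat.of k M.carrier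
      a := ModuleCat.ofHom M.coact
      counit := ModuleCat.hom_ext M.counit
      coassoc := ModuleCat.hom_ext (coact_cofree_comp_coact M) }
  map f :=
    { f := ModuleCat.ofHom (Hom.toLinearMap f)
      h := ModuleCat.hom_ext (Hom.comm f).symm }

/-- Coalgebras for the comonad `V ↦ V ⊗ C`, as comodules over `C`. -/
def ofCoalgebra : (tensorComonad k C).Coalgebra ⥤ Comod k C where
  obj M :=
    { carrier := M.A
      coact := M.a.hom
      counit := congrArg ModuleCat.Hom.hom M.counit
      coassoc := by
        refine LinearMap.ext fun m => ?_
        have h := DFunLike.congr_fun (congrArg ModuleCat.Hom.hom M.coassoc) m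
        exact ((LinearEquiv.symm_apply_eq (TensorProduct.assoc k M.A C C)).1 h).symm }
  map f :=
    { toLinearMap := f.f.hom
      comm := (congrArg ModuleCat.Hom.hom f.h).symm }

/-- The category of `C`-comodules is the category of coalgebras for the comonad `V ↦ V ⊗ C`. -/
def coalgebraEquivalence : Comod k C ≌ (tensorComonad k C).Coalgebra where
  functor := toCoalgebra k C
  inverse := ofCoalgebra k C
  unitIso := Iso.refl _
  counitIso := Iso.refl _

instance : (toCoalgebra k C).IsEquivalence := (coalgebraEquivalence k C).isEquivalence_functor

instance : PreservesFiniteLimits (tensorComonad k C).toFunctor :=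
  inferInstanceAs (PreservesFiniteLimits (tensorRight (ModuleCat.of k C)))

instance : CreatesFiniteLimits (tensorComonad k C).forget where
  createsFiniteLimits _ _ _ := { CreatesLimit := fun {K} => Comonad.forgetCreatesLimit K }

variable {k C} {D : Type u} [AddCommGroup D] [Module k D] [Coalgebra k D]

/-- Finite limits of comodules are computed on underlying vector spaces, because `- ⊗ C` is exact
over a field, and `pushforward g` does not change the underlying vector spaces. -/
instance pushforward_preservesFiniteLimits (g : C →ₗc[k] D) :
    PreservesFiniteLimits (pushforward g) := by
  have : HasFiniteLimits (tensorComonad k D).Coalgebra :=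
    hasFiniteLimits_of_hasLimitsLimits_of_createsFiniteLimits (tensorComonad k D).forget
  have : PreservesFiniteLimits
      ((pushforward g ⋙ toCoalgebra k D) ⋙ (tensorComonad k D).forget) :=
    inferInstanceAs (PreservesFiniteLimits (toCoalgebra k C ⋙ (tensorComonad k C).forget))
  have : PreservesFiniteLimits (pushforward g ⋙ toCoalgebra k D) :=
    preservesFiniteLimits_of_reflects_of_preserves _ (tensorComonad k D).forget
  exact preservesFiniteLimits_of_reflects_of_preserves _ (toCoalgebra k D)

end Limits

end Comod

end

theorem mainTheorem11 {k A : Type u} [Field k] (p : ℕ) [Fact p.Prime] [CharP k p]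
    [CommRing A] [HopfAlgebra k A] [Algebra.Smooth k A] [ConnectedSpace (PrimeSpectrum A)]
    {N : ℕ} (φ : GLCoord N k →ₐc[k] A) (hφ : Function.Surjective φ)
    (d r : ℕ) (hd : 0 < d) (hr : 0 < r) :
    (Limits.PreservesFiniteLimits (inclusionLE φ d ⋙ restrictionFrobenius k A p r) ∧
      Limits.PreservesFiniteColimits (inclusionLE φ d ⋙ restrictionFrobenius k A p r)) ∧
    Limits.PreservesFiniteLimits (inductionFrobenius k A p r ⋙ truncationLE φ d) ∧
    Nonempty ((inclusionLE φ d ⋙ restrictionFrobenius k A p r) ⊣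
      (inductionFrobenius k A p r ⋙ truncationLE φ d)) := by
  have adj := (Comod.truncationAdj (coordLE φ d)).comp
    (Comod.inductionAdj (toFrobeniusKernel k A p r))
  have := adj.leftAdjoint_preservesColimits
  have := adj.rightAdjoint_preservesLimits
  exact ⟨⟨inferInstance, inferInstance⟩, inferInstance, ⟨adj⟩⟩
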